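/- Let $\theta_0,\theta_1\in\mathbb{C}$. Consider the rank two bundle $\mathcal V=Oe_1\oplus O(-[\infty])e_2$ on $\mathbb{P}^1$ and the pairs $(\nabla,t)$ where $t\in\mathbb{C}^*$ and $\nabla$ is a connection on $\mathcal V$ for which $\tilde D=z(z-1)\nabla_{d/dz}$ has the form $$\tilde De_1=a(z)e_1+b(z)e_2,\qquad \tilde De_2=c(z)e_1+d(z)e_2,$$ with polynomials $a,b,c,d$ of degrees at most $2,1,3,2$, where $b=b_0+b_1z\neq 0$, such that: * at $z=0$, the matrix of $\frac{1}{z-1}\tilde D$ modulo $z$ has characteristic polynomial $X^2-\frac{\theta_0^2}{4}$; * at $z=1$, the matrix of $\frac1z\tilde D$ modulo $z-1$ has characteristic polynomial $X^2-\frac{\theta_1^2}{4}$; * at $z=\infty$, if $z\nabla_{d/dz}=\frac{1}{z-1}\tilde D$ is written as $z\frac{d}{dz}+B(z)$ on the local basis $e_1,\,z^{-1}e_2$, then the characteristic polynomials of $B(z)$ and of $\left(\begin{smallmatrix}-3/4&tz\\ t&-1/4\end{smallmatrix}\right)$ are equal modulo $\mathbb{C}[[z^{-1}]]$. Give this set the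 complex analytic topology (as a subspace of the finite-dimensional space of the coefficients of $a,b,c,d$ and $t$). Let $G$ be the group of automorphisms $e_1\mapsto\lambda e_1$, $e_2\mapsto e_2+(x_0+x_1z)e_1$ of $\mathcal V$ ($\lambda\in\mathbb{C}^*$, $x_0,x_1\in\mathbb{C}$), and let $\mathcal M(\theta_0,\theta_1)$ be the quotient by $G$, with the quotient topology. Let $\mathcal M_1(\theta_0,\theta_1)\subset\mathcal M(\theta_0,\theta_1)$ be the first affine part, that is, the quotient by $G$ of the open subspace $b_1\neq0$. The parameter $t$ is $G$-invariant and hence a function on $\mathcal M(\theta_0,\theta_1)$. Then for every $a\in\mathbb{C}^*$: 1. the closed subspace of $\mathcal M_1(\theta_0,\theta_1)$ given by $t=a$ is simply connected; 2. the closed subspace of $\mathcal M(\theta_0,\theta_1)$ given by $t=a$ is simply connected. (Simply connected means path connected with trivial fundamental group.) -/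

import Mathlib

open Matrix Asymptotics Bornology

noncomputable section

/-- The coefficients of the matrix of `D̃ = z (z - 1) ∇_{d/dz}` on the bundle
`O e₁ ⊕ O(-[∞]) e₂` over the projective line, together with the parameter `t`:
`D̃ e₁ = (∑ aᵢ zⁱ) e₁ + (∑ bᵢ zⁱ) e₂` and `D̃ e₂ = (∑ cᵢ zⁱ) e₁ + (∑ dᵢ zⁱ) e₂`,
where the degrees are at most `2`, `1`, `3`, `2`. -/
structure ConnCoeffs where
  a : Fin 3 → ℂ
  b : Fin 2 → ℂ
  c : Fin 4 → ℂ
  d : Fin 3 → ℂ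
  t : ℂ

namespace ConnCoeffs

/-- The usual (complex analytic) topology on the finite-dimensional space of coefficients. -/
instance : TopologicalSpace ConnCoeffs :=
  TopologicalSpace.induced (fun p => (p.a, p.b, p.c, p.d, p.t)) inferInstance

/-- The matrix of `D̃` with respect to `e₁, e₂`, at the point `z`. The connection is
`d/dz + (z (z - 1))⁻¹ • p.mat z`. -/
def mat (p : ConnCoeffs) (z : ℂ) : Matrix (Fin 2) (Fin 2) ℂ :=
  !![∑ i, p.a i * z ^ (i : ℕ), ∑ i, p.c i * z ^ (i : ℕ);
     ∑ i, p.b i * z ^ (i : ℕ), ∑ i, p.d i * z ^ (i : ℕ)]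

/-- The matrix of `z ∇_{d/dz} = (z - 1)⁻¹ D̃` with respect to the local basis `e₁, z⁻¹ e₂`
of the bundle at `z = ∞`. -/
def matInfty (p : ConnCoeffs) (z : ℂ) : Matrix (Fin 2) (Fin 2) ℂ :=
  !![p.mat z 0 0 / (z - 1), p.mat z 0 1 / (z * (z - 1));
     z * p.mat z 1 0 / (z - 1), -1 + p.mat z 1 1 / (z - 1)]

end ConnCoeffs

/-- The matrix of `z d/dz` on the prescribed invariant lattice at `z = ∞`. -/
def latticeInfty (t z : ℂ) : Matrix (Fin 2) (Fin 2) ℂ :=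
  !![-3 / 4, t * z; t, -1 / 4]

/-- The connections (with their parameter `t ∈ ℂ*`) that have the prescribed local data at
`0`, `1` and `∞`. -/
structure IsAdmissible (θ₀ θ₁ : ℂ) (p : ConnCoeffs) : Prop where
  t_ne_zero : p.t ≠ 0
  b_ne_zero : p.b ≠ 0
  /-- `(z - 1)⁻¹ D̃` modulo `z` has eigenvalues `± θ₀ / 2`. -/
  at_zero : (((0 : ℂ) - 1)⁻¹ • p.mat 0).charpoly =
    Polynomial.X ^ 2 - Polynomial.C (θ₀ ^ 2 / 4)
  /-- `z⁻¹ D̃` modulo `z - 1` has eigenvalues `± θ₁ / 2`. -/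
  at_one : ((1 : ℂ)⁻¹ • p.mat 1).charpoly =
    Polynomial.X ^ 2 - Polynomial.C (θ₁ ^ 2 / 4)
  /-- The characteristic polynomials at `∞` agree modulo `ℂ[[z⁻¹]]`. Their coefficients are
  rational functions of `z`, and such a function lies in `ℂ[[z⁻¹]]` exactly if it is bounded
  near `∞`. -/
  at_infty : ∀ i : ℕ,
    (fun z : ℂ => (p.matInfty z).charpoly.coeff i - (latticeInfty p.t z).charpoly.coeff i)
      =O[cobounded ℂ] (fun _ => (1 : ℂ))

/-- The space of all connection matrices (with `t`) with the prescribed local data. -/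
abbrev ConnSpace (θ₀ θ₁ : ℂ) : Type := {p : ConnCoeffs // IsAdmissible θ₀ θ₁ p}

/-- The bundle automorphism `e₁ ↦ l e₁`, `e₂ ↦ e₂ + (x₀ + x₁ z) e₁`. -/
def gaugeMat (l x₀ x₁ z : ℂ) : Matrix (Fin 2) (Fin 2) ℂ :=
  !![l, x₀ + x₁ * z; 0, 1]

/-- The derivative of `gaugeMat l x₀ x₁` with respect to `z`. -/
def gaugeMatDeriv (x₁ : ℂ) : Matrix (Fin 2) (Fin 2) ℂ :=
  !![0, x₁; 0, 0]

/-- Two connections lie in the same orbit of the automorphism group of the bundle: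
`D̃` has the matrix `q.mat` with respect to the transformed basis. -/
def GaugeEquiv (p q : ConnCoeffs) : Prop :=
  q.t = p.t ∧ ∃ l x₀ x₁ : ℂ, l ≠ 0 ∧ ∀ z : ℂ,
    gaugeMat l x₀ x₁ z * q.mat z =
      p.mat z * gaugeMat l x₀ x₁ z + (z * (z - 1)) • gaugeMatDeriv x₁

theorem GaugeEquiv.refl (p : ConnCoeffs) : GaugeEquiv p p := by
  refine ⟨rfl, 1, 0, 0, one_ne_zero, fun z => ?_⟩
  have h1 : gaugeMat 1 0 0 z = 1 := by
    ext i j; fin_cases i <;> fin_cases j <;> simp [gaugeMat]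
  have h2 : gaugeMatDeriv 0 = 0 := by
    ext i j; fin_cases i <;> fin_cases j <;> simp [gaugeMatDeriv]
  simp [h1, h2]

theorem GaugeEquiv.symm {p q : ConnCoeffs} (h : GaugeEquiv p q) : GaugeEquiv q p := by
  obtain ⟨ht, l, x, y, hl, h⟩ := h
  refine ⟨ht.symm, l⁻¹, -x / l, -y / l, inv_ne_zero hl, fun z => ?_⟩
  have hQP : gaugeMat l⁻¹ (-x / l) (-y / l) z * gaugeMat l x y z = 1 := by
    ext i j; fin_cases i <;> fin_cases j <;> simp [gaugeMat, Matrix.mul_apply] <;> field_simp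
    ring
  have hPQ : gaugeMat l x y z * gaugeMat l⁻¹ (-x / l) (-y / l) z = 1 :=
    mul_eq_one_comm.mp hQP
  have hD : gaugeMatDeriv (-y / l) = -(gaugeMat l⁻¹ (-x / l) (-y / l) z * gaugeMatDeriv y *
      gaugeMat l⁻¹ (-x / l) (-y / l) z) := by
    ext i j; fin_cases i <;> fin_cases j <;>
      simp [gaugeMat, gaugeMatDeriv, Matrix.mul_apply] <;> field_simp
  have h3 := congrArg (fun M => gaugeMat l⁻¹ (-x / l) (-y / l) z * M *
    gaugeMat l⁻¹ (-x / l) (-y / l) z) (h z)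
  simp only [mul_add, add_mul, Matrix.mul_smul, Matrix.smul_mul] at h3
  rw [← mul_assoc, hQP, one_mul, mul_assoc _ _ (gaugeMat l⁻¹ _ _ z), mul_assoc (p.mat z), hPQ,
    mul_one] at h3
  rw [hD, h3, smul_neg, add_neg_cancel_right]

theorem GaugeEquiv.trans {p q r : ConnCoeffs} (h : GaugeEquiv p q) (h' : GaugeEquiv q r) :
    GaugeEquiv p r := by
  obtain ⟨ht, l, x, y, hl, h⟩ := h
  obtain ⟨ht', l', x', y', hl', h'⟩ := h'
  refine ⟨ht'.trans ht, l * l', l * x' + x, l * y' + y, mul_ne_zero hl hl', fun z => ?_⟩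
  have hP : gaugeMat (l * l') (l * x' + x) (l * y' + y) z =
      gaugeMat l x y z * gaugeMat l' x' y' z := by
    ext i j; fin_cases i <;> fin_cases j <;> simp [gaugeMat, Matrix.mul_apply]
    ring
  have hD : gaugeMatDeriv (l * y' + y) = gaugeMatDeriv y * gaugeMat l' x' y' z +
      gaugeMat l x y z * gaugeMatDeriv y' := by
    ext i j; fin_cases i <;> fin_cases j <;>
      simp [gaugeMat, gaugeMatDeriv, Matrix.mul_apply]
    ring
  rw [hP, hD, mul_assoc, h' z, mul_add, ← mul_assoc, h z, add_mul, Matrix.mul_smul,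
    Matrix.smul_mul, smul_add, mul_assoc, add_assoc]

/-- The orbit relation on the connections with the prescribed local data. -/
def gaugeSetoid (θ₀ θ₁ : ℂ) : Setoid (ConnSpace θ₀ θ₁) where
  r p q := GaugeEquiv p.1 q.1
  iseqv := ⟨fun p => .refl p.1, fun h => h.symm, fun h h' => h.trans h'⟩

/-- The moduli space `ℳ(θ₀, θ₁)`: the orbit space of the connection matrices under the
automorphism group of the bundle, with the quotient of the complex analytic topology. -/
def ModuliSpace (θ₀ θ₁ : ℂ) : Type := Quotient (gaugeSetoid θ₀ θ₁)

namespace ModuliSpace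

variable {θ₀ θ₁ : ℂ}

instance : TopologicalSpace (ModuliSpace θ₀ θ₁) :=
  inferInstanceAs (TopologicalSpace (Quotient (gaugeSetoid θ₀ θ₁)))

/-- The class of a connection. -/
def mk (p : ConnSpace θ₀ θ₁) : ModuliSpace θ₀ θ₁ := Quotient.mk _ p

/-- The function `t` on the moduli space. -/
def t (m : ModuliSpace θ₀ θ₁) : ℂ :=
  Quotient.lift (fun p : ConnSpace θ₀ θ₁ => p.1.t) (fun p q h => (show GaugeEquiv p.1 q.1 from h).1.symm) m

end ModuliSpace

/-- The first affine part `ℳ₁(θ₀, θ₁)` of the moduli space: the quotient of the open subspace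
`b₁ ≠ 0` of the space of connection matrices. -/
def firstAffinePart (θ₀ θ₁ : ℂ) : Set (ModuliSpace θ₀ θ₁) :=
  ModuliSpace.mk '' {p | p.1.b 1 ≠ 0}

end

/-! Fix `t = a`. Where `b₁ ≠ 0`, the group acts freely and each orbit contains exactly one
connection with `b = z - q` and constant diagonal entry `p`. The condition at infinity then forces
`c₃ = 0` and `c₂ = a²`. With `u = c(0)` and `v = -c(1)`, the conditions at `0` and `1` become `q u =
p² - θ₀²/4` and `(1 - q) v = p² - θ₁²/4`. So the fibre of the first affine part is this surface in
`ℂ⁴`.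

The surface is simply connected by van Kampen. Over `Re q < 2/3` the coordinate `v` is redundant,
over `Re q > 1/3` the coordinate `u` is, and over the strip between them the surface is a graph.
What remains is a part of the quadric `q u = p² - g²`. For `g = 0` it is a star-shaped cone. For `g
≠ 0` the two lines over `q = 0` can be removed one at a time. Each complement is a half-plane times
`ℂ`, and their intersection is a punctured half-plane times `ℂ`.

The full fibre also contains the locus `b₁ = 0`. Where `b₀ ≠ 0`, normalise `b₀ = 1` and `a = a₂ z²`.
Near the locus `c₃ ≠ 0`, and `σ = a₂ / c₃` together with `c₂` are local coordinates, in which the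
locus is the line `σ = 0`. A star-shaped neighbourhood of that line is glued to the first affine
part along its path-connected complement of the line, so van Kampen applies again. -/

open Set

/-! ### Van Kampen for two simply connected open sets -/

section VanKampen

variable {X : Type*} [TopologicalSpace X]

theorem IsSimplyConnected.homotopic_of_range_subset {U : Set X} (hU : IsSimplyConnected U)
    {x y : X} {p q : Path x y} (hp : range p ⊆ U) (hq : range q ⊆ U) : p.Homotopic q := by
  have := hU.simplyConnectedSpace
  have hx : x ∈ U := hp ⟨0, p.source⟩
  have hy : y ∈ U := hp ⟨1, p.target⟩
  let p' : Path (⟨x, hx⟩ : U) ⟨y, hy⟩ :=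
    { toFun := fun t => ⟨p t, hp ⟨t, rfl⟩⟩
      source' := by simp
      target' := by simp }
  let q' : Path (⟨x, hx⟩ : U) ⟨y, hy⟩ :=
    { toFun := fun t => ⟨q t, hq ⟨t, rfl⟩⟩
      source' := by simp
      target' := by simp }
  exact (SimplyConnectedSpace.paths_homotopic p' q').map ⟨Subtype.val, continuous_subtype_val⟩

theorem IsPathConnected.exists_path_range_subset {U : Set X} (hU : IsPathConnected U) {x y : X}
    (hx : x ∈ U) (hy : y ∈ U) : ∃ p : Path x y, range p ⊆ U := by
  obtain ⟨p, hp⟩ := hU.joinedIn x hx y hy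
  exact ⟨p, range_subset_iff.2 hp⟩

/-- The simply connected case of the Seifert-van Kampen theorem. -/
theorem simplyConnectedSpace_of_union {U V : Set X} (hUo : IsOpen U) (hVo : IsOpen V)
    (hUV : U ∪ V = univ) (hU : IsSimplyConnected U) (hV : IsSimplyConnected V)
    (h : IsPathConnected (U ∩ V)) : SimplyConnectedSpace X := by
  obtain ⟨x₀, hx₀U, hx₀V⟩ := h.nonempty
  let W : Bool → Set X := fun i => cond i U V
  have hWo : ∀ i, IsOpen (W i) := by rintro (_ | _) <;> assumption
  have hW : ∀ i, IsSimplyConnected (W i) := by rintro (_ | _) <;> assumption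
  have hx₀ : ∀ i, x₀ ∈ W i := by rintro (_ | _) <;> assumption
  have hcov : ∀ x, ∃ i, x ∈ W i := fun x => by
    rcases (hUV.symm ▸ mem_univ x : x ∈ U ∪ V) with hx | hx
    exacts [⟨true, hx⟩, ⟨false, hx⟩]
  have hpair : ∀ i j x, x ∈ W i → x ∈ W j → ∃ p : Path x₀ x, range p ⊆ W i ∧ range p ⊆ W j := by
    have key : ∀ x, x ∈ U → x ∈ V → ∃ p : Path x₀ x, range p ⊆ U ∧ range p ⊆ V := fun x hxU hxV => by
      obtain ⟨p, hp⟩ := h.exists_path_range_subset ⟨hx₀U, hx₀V⟩ ⟨hxU, hxV⟩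
      exact ⟨p, hp.trans inter_subset_left, hp.trans inter_subset_right⟩
    rintro (_ | _) (_ | _) x hi hj
    · obtain ⟨p, hp⟩ := hV.isPathConnected.exists_path_range_subset hx₀V hi
      exact ⟨p, hp, hp⟩
    · exact (key x hj hi).imp fun p hp => hp.symm
    · exact key x hi hj
    · obtain ⟨p, hp⟩ := hU.isPathConnected.exists_path_range_subset hx₀U hi
      exact ⟨p, hp, hp⟩
  -- A reference path to each point, independent up to homotopy of the piece it runs in: over a
  -- point of `U ∩ V`, paths in `U` and paths in `V` are both compared with a path in `U ∩ V`.
  have hc : ∀ x, ∃ c : Path x₀ x, ∀ i, ∀ p : Path x₀ x, range p ⊆ W i → p.Homotopic c := fun x => by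
    obtain ⟨i, hi⟩ := hcov x
    obtain ⟨c, hc, -⟩ := hpair i i x hi hi
    refine ⟨c, fun j p hp => ?_⟩
    obtain ⟨d, hdi, hdj⟩ := hpair i j x hi (hp ⟨1, p.target⟩)
    exact ((hW j).homotopic_of_range_subset hp hdj).trans
      ((hW i).homotopic_of_range_subset hdi hc)
  choose c hc using hc
  have hsmall : ∀ {x y : X} (i) (γ : Path x y), range γ ⊆ W i →
      ((c x).trans γ).Homotopic (c y) := fun {x y} i γ hγ => by
    obtain ⟨d, hd⟩ := (hW i).isPathConnected.exists_path_range_subset (hx₀ i)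
      (hγ ⟨0, γ.source⟩)
    refine ((hc x i d hd).symm.hcomp (.refl γ)).trans (hc y i _ ?_)
    rw [Path.trans_range]
    exact union_subset hd hγ
  -- Subdivide `γ` so that each piece lies in `U` or in `V` and absorb the pieces one by one. Hence
  -- every path from `x` to `y` is homotopic to `(c x).symm.trans (c y)`.
  have hall : ∀ {x y : X} (γ : Path x y), ((c x).trans γ).Homotopic (c y) := fun {x y} γ => by
    obtain ⟨t, ht0, htm, ⟨n, hn⟩, ht⟩ :=
      exists_monotone_Icc_subset_open_cover_unitInterval (c := fun i => γ ⁻¹' W i)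
        (fun i => (hWo i).preimage γ.continuous)
        (fun s _ => mem_iUnion.2 (hcov (γ s)))
    have step : ∀ k, ((c (γ 0)).trans (γ.subpath 0 (t k))).Homotopic (c (γ (t k))) := by
      intro k
      induction k with
      | zero =>
        rw [ht0, Path.subpath_self]
        exact ⟨Path.Homotopy.transRefl _⟩
      | succ k ih =>
        obtain ⟨i, hi⟩ := ht k
        have h1 := hsmall i (γ.subpath (t k) (t (k + 1))) (by
          rw [Path.range_subpath_of_le _ _ _ (htm k.le_succ)]
          exact image_subset_iff.2 hi)
        have h2 : ((γ.subpath 0 (t k)).trans (γ.subpath (t k) (t (k + 1)))).Homotopic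
            (γ.subpath 0 (t (k + 1))) := ⟨Path.Homotopy.subpathTransSubpath γ _ _ _⟩
        exact ((Path.Homotopic.refl _).hcomp h2.symm).trans
          ((Path.Homotopic.symm ⟨Path.Homotopy.transAssoc _ _ _⟩).trans
            ((ih.hcomp (.refl _)).trans h1))
    have h1 := step n
    rw [hn n le_rfl, Path.subpath_zero_one] at h1
    -- The subpaths start and end at `γ 0` and `γ 1`, which equal `x` and `y` only propositionally.
    have hcast : ∀ {x' y' : X} (hx : x' = x) (hy : y' = y),
        ((c x').trans (γ.cast hx hy)).Homotopic (c y') → ((c x).trans γ).Homotopic (c y) := by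
      rintro _ _ rfl rfl h
      exact h
    exact hcast γ.source γ.target h1
  refine simply_connected_iff_paths_homotopic'.2 ⟨⟨⟨x₀⟩, fun x y => ⟨(c x).symm.trans (c y)⟩⟩,
    fun {x y} p q => ?_⟩
  have cancel : ∀ p : Path x y, p.Homotopic ((c x).symm.trans (c y)) := fun p =>
    (Path.Homotopic.symm ⟨Path.Homotopy.reflTrans p⟩).trans
      (((Path.Homotopic.hcomp ⟨Path.Homotopy.reflSymmTrans (c x)⟩ (.refl p))).trans
        ((Path.Homotopic.trans ⟨Path.Homotopy.transAssoc _ _ _⟩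
          ((Path.Homotopic.refl _).hcomp (hall p)))))
  exact (cancel p).trans (cancel q).symm

theorem isSimplyConnected_of_union {s U V : Set X} (hUo : IsOpen U) (hVo : IsOpen V)
    (hs : s ⊆ U ∪ V) (hU : IsSimplyConnected (s ∩ U)) (hV : IsSimplyConnected (s ∩ V))
    (h : IsPathConnected (s ∩ (U ∩ V))) : IsSimplyConnected s := by
  have e : Topology.IsEmbedding (Subtype.val : s → X) := .subtypeVal
  refine simplyConnectedSpace_of_union (hUo.preimage continuous_subtype_val)
    (hVo.preimage continuous_subtype_val) ?_ ?_ ?_ ?_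
  · exact eq_univ_of_forall fun x => hs x.2
  · rwa [← e.isSimplyConnected_image, Subtype.image_preimage_coe]
  · rwa [← e.isSimplyConnected_image, Subtype.image_preimage_coe]
  · rwa [← preimage_inter, e.isInducing.isPathConnected_iff, Subtype.image_preimage_coe]

theorem IsSimplyConnected.image_of_leftInvOn {Y : Type*} [TopologicalSpace Y] {s : Set X}
    (hs : IsSimplyConnected s) {f : X → Y} {g : Y → X} (hf : ContinuousOn f s)
    (hg : ContinuousOn g (f '' s)) (h : LeftInvOn g f s) : IsSimplyConnected (f '' s) := by
  have hmem : ∀ y : f '' s, g y ∈ s := by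
    rintro ⟨_, x, hx, rfl⟩
    exact (h hx).symm ▸ hx
  have hr : ∀ y : f '' s, f (g y) = y := by
    rintro ⟨_, x, hx, rfl⟩
    exact congrArg f (h hx)
  let e : s ≃ₜ f '' s :=
    { toFun := fun x => ⟨f x, mem_image_of_mem f x.2⟩
      invFun := fun y => ⟨g y, hmem y⟩
      left_inv := fun x => Subtype.ext (h x.2)
      right_inv := fun y => Subtype.ext (hr y)
      continuous_toFun := (continuousOn_iff_continuous_domRestrict.1 hf).subtype_mk _
      continuous_invFun := (continuousOn_iff_continuous_domRestrict.1 hg).subtype_mk _ }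
  have := hs.simplyConnectedSpace
  exact e.symm.toHomotopyEquiv.simplyConnectedSpace

end VanKampen

theorem StarConvex.isSimplyConnected {E : Type*} [AddCommGroup E] [Module ℝ E]
    [TopologicalSpace E] [ContinuousAdd E] [ContinuousSMul ℝ E] {x : E} {s : Set E}
    (h : StarConvex ℝ x s) (hs : s.Nonempty) : IsSimplyConnected s := by
  have := h.contractibleSpace hs
  exact SimplyConnectedSpace.ofContractible s

/-! ### Topology of the quadric and of the surface -/

section Quadric

open ComplexConjugate

/-- Four convex pieces surround the origin, each meeting the union of the previous ones. -/
theorem isPathConnected_punctured_halfPlane {r : ℝ} (hr : 0 < r) :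
    IsPathConnected {z : ℂ | z.re < r ∧ z ≠ 0} := by
  have hA : IsPathConnected {z : ℂ | z.re < r ∧ 0 < z.im} :=
    ((convex_halfSpace_re_lt r).inter (convex_halfSpace_im_gt 0)).isPathConnected
      ⟨⟨r / 2, 1⟩, by simpa using hr⟩
  have hB : IsPathConnected {z : ℂ | z.re < r ∧ z.im < 0} :=
    ((convex_halfSpace_re_lt r).inter (convex_halfSpace_im_lt 0)).isPathConnected
      ⟨⟨r / 2, -1⟩, by simpa using hr⟩
  have hC : IsPathConnected {z : ℂ | z.re < r ∧ 0 < z.re} :=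
    ((convex_halfSpace_re_lt r).inter (convex_halfSpace_re_gt 0)).isPathConnected
      ⟨⟨r / 2, 0⟩, by simpa using hr⟩
  have hD : IsPathConnected {z : ℂ | z.re < 0} :=
    (convex_halfSpace_re_lt 0).isPathConnected ⟨⟨-1, 0⟩, by simp⟩
  have h1 := hA.union hC ⟨⟨r / 2, 1⟩, by simpa using hr⟩
  have h2 := h1.union hD ⟨⟨-1, 1⟩, Or.inl ⟨show (-1 : ℝ) < r by linarith, show (0 : ℝ) < 1 by simp⟩,
    show (-1 : ℝ) < 0 by simp⟩
  have h3 := h2.union hB ⟨⟨-1, -1⟩, Or.inr (show (-1 : ℝ) < 0 by simp),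
    ⟨show (-1 : ℝ) < r by linarith, show (-1 : ℝ) < 0 by simp⟩⟩
  convert h3 using 1
  ext z
  simp only [mem_ofPred_eq, mem_union, ne_eq, Complex.ext_iff, Complex.zero_re, Complex.zero_im]
  grind

/-- The part `Re q < r` of the affine quadric `q u = p² - α`. -/
def quadricPart (r : ℝ) (α : ℂ) : Set (ℂ × ℂ × ℂ) :=
  {x | x.1 * x.2.2 = x.2.1 ^ 2 - α ∧ x.1.re < r}

/-- From `q u = (p - g)(p + g)`, the ratio `w = (p - g) / q = u / (p + g)` is defined away from the
removed line, and `(q, w)` are global coordinates there. -/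
theorem isSimplyConnected_quadric_chart (r : ℝ) (hr : 0 < r) {g : ℂ} (hg : g ≠ 0) :
    IsSimplyConnected (quadricPart r (g ^ 2) ∩ {x | ¬(x.1 = 0 ∧ x.2.1 = -g)}) := by
  have hK : IsSimplyConnected {x : ℂ × ℂ | x.1.re < r} := by
    refine StarConvex.isSimplyConnected (x := 0) (Convex.starConvex ?_ ?_) ⟨0, ?_⟩
    · exact (convex_halfSpace_re_lt r).linear_preimage (LinearMap.fst ℝ ℂ ℂ)
    · simpa using hr
    · simpa using hr
  have hden : ∀ {x : ℂ × ℂ × ℂ}, ¬(x.1 = 0 ∧ x.2.1 = -g) →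
      conj x.1 * x.1 + conj (x.2.1 + g) * (x.2.1 + g) ≠ 0 := fun {x} hx h0 => by
    rw [← Complex.normSq_eq_conj_mul_self, ← Complex.normSq_eq_conj_mul_self] at h0
    have h0' : Complex.normSq x.1 + Complex.normSq (x.2.1 + g) = 0 := by exact_mod_cast h0
    have h1 := Complex.normSq_nonneg x.1
    have h2 := Complex.normSq_nonneg (x.2.1 + g)
    exact hx ⟨Complex.normSq_eq_zero.1 (by linarith),
      eq_neg_of_add_eq_zero_left (Complex.normSq_eq_zero.1 (by linarith))⟩
  let f : ℂ × ℂ → ℂ × ℂ × ℂ := fun x => (x.1, g + x.1 * x.2, x.2 * (2 * g + x.1 * x.2))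
  -- The least-squares solution of `q w = p - g`, `(p + g) w = u`. It gives both ratios by one
  -- continuous formula, with a denominator that vanishes only on the removed line.
  let k : ℂ × ℂ × ℂ → ℂ × ℂ := fun x => (x.1,
    (conj x.1 * (x.2.1 - g) + conj (x.2.1 + g) * x.2.2) /
      (conj x.1 * x.1 + conj (x.2.1 + g) * (x.2.1 + g)))
  have him : f '' {x : ℂ × ℂ | x.1.re < r} =
      quadricPart r (g ^ 2) ∩ {x | ¬(x.1 = 0 ∧ x.2.1 = -g)} := by
    ext ⟨q, p, u⟩
    constructor
    · rintro ⟨⟨q, w⟩, hq, h⟩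
      simp only [f, Prod.mk.injEq] at h
      obtain ⟨rfl, rfl, rfl⟩ := h
      refine ⟨⟨by simp only; ring, hq⟩, ?_⟩
      rintro ⟨h1, h2⟩
      simp only at h1 h2
      subst h1
      exact hg (by linear_combination h2 / 2)
    · rintro ⟨⟨h1, h2⟩, h3⟩
      have hd := hden h3
      simp only at h1 h2 h3 hd
      refine ⟨k (q, p, u), h2, ?_⟩
      have hw1 : q * (k (q, p, u)).2 = p - g := by
        simp only [k]
        rw [mul_div_assoc', div_eq_iff hd]
        linear_combination conj (p + g) * h1
      have hw2 : (p + g) * (k (q, p, u)).2 = u := by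
        simp only [k]
        rw [mul_div_assoc', div_eq_iff hd]
        linear_combination -conj q * h1
      refine Prod.ext rfl (Prod.ext ?_ ?_)
      · change g + q * (k (q, p, u)).2 = p
        rw [hw1]; ring
      · change (k (q, p, u)).2 * (2 * g + q * (k (q, p, u)).2) = u
        rw [hw1]
        linear_combination hw2
  rw [← him]
  refine hK.image_of_leftInvOn (g := k) ?_ ?_ ?_
  · exact Continuous.continuousOn (by fun_prop)
  · rw [him]
    refine ContinuousOn.prodMk (by fun_prop) (ContinuousOn.div ?_ ?_ fun x hx => hden hx.2)
    · exact Continuous.continuousOn (by fun_prop)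
    · exact Continuous.continuousOn (by fun_prop)
  · rintro ⟨q, w⟩ hq
    have hd := hden (him ▸ mem_image_of_mem f hq :
      f (q, w) ∈ quadricPart r (g ^ 2) ∩ {x | ¬(x.1 = 0 ∧ x.2.1 = -g)}).2
    refine Prod.ext rfl ?_
    simp only [k]
    rw [div_eq_iff hd]
    simp only [f]
    ring

theorem isSimplyConnected_quadricPart {r : ℝ} (hr : 0 < r) (α : ℂ) :
    IsSimplyConnected (quadricPart r α) := by
  obtain ⟨g, rfl⟩ : ∃ g : ℂ, α = g ^ 2 := (IsAlgClosed.exists_pow_nat_eq α two_pos).imp fun _ h => h.symm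
  by_cases hg : g = 0
  · subst hg
    refine StarConvex.isSimplyConnected (x := 0) ?_ ⟨0, by simpa [quadricPart] using hr⟩
    rw [starConvex_zero_iff]
    rintro ⟨q, p, u⟩ ⟨h1, h2⟩ l hl0 hl1
    simp only [] at h1 h2
    refine ⟨?_, ?_⟩
    · simp only [Prod.smul_mk, Complex.real_smul]
      linear_combination (l : ℂ) ^ 2 * h1
    · simp only [Prod.smul_mk, Complex.real_smul, Complex.re_ofReal_mul]
      rcases le_total q.re 0 with h | h
      · exact (mul_nonpos_of_nonneg_of_nonpos hl0 h).trans_lt hr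
      · exact (mul_le_of_le_one_left h hl1).trans_lt h2
  · have hV := isSimplyConnected_quadric_chart r hr (neg_ne_zero.2 hg)
    rw [neg_sq, neg_neg] at hV
    have hclosed : ∀ g : ℂ, IsOpen {x : ℂ × ℂ × ℂ | ¬(x.1 = 0 ∧ x.2.1 = g)} := fun g =>
      ((isClosed_eq (by fun_prop) (by fun_prop)).inter
        (isClosed_eq (by fun_prop) (by fun_prop))).isOpen_compl
    refine isSimplyConnected_of_union (hclosed (-g)) (hclosed g) ?_
      (isSimplyConnected_quadric_chart r hr hg) hV ?_
    · rintro x -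
      by_contra h
      simp only [mem_union, mem_ofPred_eq, not_or, not_not] at h
      have := h.1.2.symm.trans h.2.2
      exact hg (by linear_combination -this / 2)
    -- Over `q = 0` one has `p = ±g`, so removing both lines leaves exactly `q ≠ 0`, where `u` is a
    -- function of `(q, p)`.
    · have hp := ((isPathConnected_punctured_halfPlane hr).prod
        (isPathConnected_univ (X := ℂ))).image'
        (f := fun x : ℂ × ℂ => (x.1, x.2, (x.2 ^ 2 - g ^ 2) / x.1))
        (ContinuousOn.prodMk (by fun_prop) (ContinuousOn.prodMk (by fun_prop)
          (ContinuousOn.div (by fun_prop) (by fun_prop) fun x hx => hx.1.2)))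
      convert hp using 1
      ext ⟨q, p, u⟩
      constructor
      · rintro ⟨⟨h1, h2⟩, h3, h4⟩
        simp only [mem_ofPred_eq] at h1 h2 h3 h4
        have hq : q ≠ 0 := by
          rintro rfl
          have : (p - g) * (p + g) = 0 := by linear_combination -h1
          rcases mul_eq_zero.1 this with h | h
          · exact h4 ⟨rfl, by linear_combination h⟩
          · exact h3 ⟨rfl, by linear_combination h⟩
        refine ⟨(q, p), ⟨⟨h2, hq⟩, mem_univ _⟩, ?_⟩
        simp only [Prod.mk.injEq, true_and]
        rw [div_eq_iff hq, ← h1, mul_comm]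
      · rintro ⟨⟨q, p⟩, ⟨⟨h1, h2⟩, -⟩, h⟩
        simp only [Prod.mk.injEq] at h h1 h2
        obtain ⟨rfl, rfl, rfl⟩ := h
        refine ⟨⟨?_, h1⟩, fun h => h2 h.1, fun h => h2 h.1⟩
        simp only
        field_simp

/-- The affine surface `q u = p² - α`, `(1 - q) v = p² - β`. -/
def biconicSurface (α β : ℂ) : Set (ℂ × ℂ × ℂ × ℂ) :=
  {x | x.1 * x.2.2.1 = x.2.1 ^ 2 - α ∧ (1 - x.1) * x.2.2.2 = x.2.1 ^ 2 - β}

theorem isSimplyConnected_biconicSurface (α β : ℂ) :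
    IsSimplyConnected (biconicSurface α β) := by
  have h23 : (0 : ℝ) < 2 / 3 := by norm_num
  have hne : ∀ {q : ℂ}, q.re < 2 / 3 → 1 - q ≠ 0 := fun {q} hq h => by
    rw [← sub_eq_zero.1 h] at hq
    norm_num at hq
  have hne' : ∀ {q : ℂ}, 1 / 3 < q.re → q ≠ 0 := fun {q} hq h => by
    rw [h] at hq
    norm_num at hq
  refine isSimplyConnected_of_union (U := {x | x.1.re < 2 / 3}) (V := {x | 1 / 3 < x.1.re})
    (isOpen_lt (by fun_prop) (by fun_prop)) (isOpen_lt (by fun_prop) (by fun_prop)) ?_ ?_ ?_ ?_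
  · intro x _
    rcases lt_or_ge x.1.re (2 / 3) with h | h
    · exact Or.inl h
    · exact Or.inr (show (1 / 3 : ℝ) < x.1.re by linarith)
  · have him : (fun x : ℂ × ℂ × ℂ => (x.1, x.2.1, x.2.2, (x.2.1 ^ 2 - β) / (1 - x.1))) ''
        quadricPart (2 / 3) α = biconicSurface α β ∩ {x | x.1.re < 2 / 3} := by
      ext ⟨q, p, u, v⟩
      constructor
      · rintro ⟨⟨q, p, u⟩, ⟨h1, h2⟩, h⟩
        simp only [Prod.mk.injEq] at h h1 h2
        obtain ⟨rfl, rfl, rfl, rfl⟩ := h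
        exact ⟨⟨h1, mul_div_cancel₀ _ (hne h2)⟩, h2⟩
      · rintro ⟨⟨h1, h2⟩, h3⟩
        refine ⟨(q, p, u), ⟨h1, h3⟩, ?_⟩
        simp only [Prod.mk.injEq, true_and]
        rw [div_eq_iff (hne h3), ← h2, mul_comm]
    rw [← him]
    refine (isSimplyConnected_quadricPart h23 α).image_of_leftInvOn
      (g := fun x => (x.1, x.2.1, x.2.2.1)) ?_ (Continuous.continuousOn (by fun_prop))
      (fun x _ => rfl)
    exact ContinuousOn.prodMk (by fun_prop) (ContinuousOn.prodMk (by fun_prop)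
      (ContinuousOn.prodMk (by fun_prop)
      (ContinuousOn.div (by fun_prop) (by fun_prop) fun x hx => hne hx.2)))
  · have him : (fun x : ℂ × ℂ × ℂ => (1 - x.1, x.2.1, (x.2.1 ^ 2 - α) / (1 - x.1), x.2.2)) ''
        quadricPart (2 / 3) β = biconicSurface α β ∩ {x | 1 / 3 < x.1.re} := by
      ext ⟨q, p, u, v⟩
      constructor
      · rintro ⟨⟨q, p, v⟩, ⟨h1, h2⟩, h⟩
        simp only [Prod.mk.injEq] at h h1 h2
        obtain ⟨rfl, rfl, rfl, rfl⟩ := h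
        refine ⟨⟨mul_div_cancel₀ _ (hne h2), ?_⟩, ?_⟩
        · simpa using h1
        · simp only [mem_ofPred_eq, Complex.sub_re, Complex.one_re]
          linarith
      · rintro ⟨⟨h1, h2⟩, h3⟩
        simp only [mem_ofPred_eq] at h1 h2 h3
        refine ⟨(1 - q, p, v), ⟨h2, ?_⟩, ?_⟩
        · simp only [Complex.sub_re, Complex.one_re]
          linarith
        · simp only [sub_sub_cancel, Prod.mk.injEq, true_and, and_true]
          rw [div_eq_iff (hne' h3), ← h1, mul_comm]
    rw [← him]
    refine (isSimplyConnected_quadricPart h23 β).image_of_leftInvOn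
      (g := fun x => (1 - x.1, x.2.1, x.2.2.2)) ?_ (Continuous.continuousOn (by fun_prop))
      (fun x _ => by simp)
    exact ContinuousOn.prodMk (by fun_prop) (ContinuousOn.prodMk (by fun_prop)
      (ContinuousOn.prodMk
      (ContinuousOn.div (by fun_prop) (by fun_prop) fun x hx => hne hx.2) (by fun_prop)))
  · have hstrip : IsPathConnected {z : ℂ | z.re < 2 / 3 ∧ 1 / 3 < z.re} :=
      ((convex_halfSpace_re_lt _).inter (convex_halfSpace_re_gt _)).isPathConnected
        ⟨⟨1 / 2, 0⟩, by norm_num⟩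
    have hp := (hstrip.prod (isPathConnected_univ (X := ℂ))).image'
        (f := fun x : ℂ × ℂ => (x.1, x.2, (x.2 ^ 2 - α) / x.1, (x.2 ^ 2 - β) / (1 - x.1)))
        (ContinuousOn.prodMk (by fun_prop) (ContinuousOn.prodMk (by fun_prop)
          (ContinuousOn.prodMk
          (ContinuousOn.div (by fun_prop) (by fun_prop) fun x hx => hne' hx.1.2)
          (ContinuousOn.div (by fun_prop) (by fun_prop) fun x hx => hne hx.1.1))))
    convert hp using 1
    ext ⟨q, p, u, v⟩
    constructor
    · rintro ⟨⟨h1, h2⟩, h3, h4⟩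
      refine ⟨(q, p), ⟨⟨h3, h4⟩, mem_univ _⟩, ?_⟩
      simp only [Prod.mk.injEq, true_and]
      rw [div_eq_iff (hne h3), div_eq_iff (hne' h4), ← h1, ← h2]
      exact ⟨mul_comm _ _, mul_comm _ _⟩
    · rintro ⟨⟨q, p⟩, ⟨⟨h1, h2⟩, -⟩, h⟩
      simp only [Prod.mk.injEq] at h h1 h2
      obtain ⟨rfl, rfl, rfl, rfl⟩ := h
      exact ⟨⟨mul_div_cancel₀ _ (hne' h2), mul_div_cancel₀ _ (hne h1)⟩, h1, h2⟩

end Quadric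

/-! ### The local conditions as polynomial equations -/

section Asymptotics

open Filter Polynomial in
-- Expansion in powers of `z - 1` fits the denominators of the matrix at infinity. Boundedness kills
-- the positive powers, since a nonconstant polynomial is unbounded.
theorem isBigO_cobounded_one_iff (k₂ k₁ k₀ m₁ m₂ : ℂ) :
    (fun z : ℂ => k₂ * (z - 1) ^ 2 + k₁ * (z - 1) + k₀ + m₁ * (z - 1)⁻¹ + m₂ * ((z - 1)⁻¹) ^ 2)
      =O[cobounded ℂ] (fun _ => (1 : ℂ)) ↔ k₂ = 0 ∧ k₁ = 0 := by
  have hinv : (fun z : ℂ => (z - 1)⁻¹) =O[cobounded ℂ] (fun _ => (1 : ℂ)) := by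
    refine Tendsto.isBigO_one ℂ (c := (0 : ℂ)) ?_
    exact tendsto_inv₀_cobounded.comp (tendsto_sub_const_cobounded 1)
  have hrest : (fun z : ℂ => k₀ + m₁ * (z - 1)⁻¹ + m₂ * ((z - 1)⁻¹) ^ 2)
      =O[cobounded ℂ] (fun _ => (1 : ℂ)) := by
    refine ((isBigO_const_const _ one_ne_zero _).add (hinv.const_mul_left _)).add
      (IsBigO.const_mul_left ?_ _)
    simpa using hinv.pow 2
  constructor
  · intro h
    have h2 : (fun z : ℂ => (C k₂ * X ^ 2 + C k₁ * X : ℂ[X]).eval (z - 1))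
        =O[cobounded ℂ] (fun _ => (1 : ℂ)) := by
      refine (h.sub hrest).congr_left fun z => ?_
      simp only [eval_add, eval_mul, eval_C, eval_pow, eval_X]
      ring
    have hdeg : (C k₂ * X ^ 2 + C k₁ * X : ℂ[X]).degree ≤ 0 := by
      by_contra! hd
      have ht := Polynomial.tendsto_norm_atTop _ hd
        (tendsto_norm_atTop_iff_cobounded.2 (tendsto_sub_const_cobounded (1 : ℂ)))
      obtain ⟨M, hM⟩ := h2.bound
      obtain ⟨z, hz1, hz2⟩ := (hM.and (ht.eventually_gt_atTop (M * ‖(1 : ℂ)‖))).exists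
      exact absurd hz1 (not_le.2 hz2)
    have h1 := congrArg (fun P : ℂ[X] => P.coeff 1) (eq_C_of_degree_le_zero hdeg)
    have h2 := congrArg (fun P : ℂ[X] => P.coeff 2) (eq_C_of_degree_le_zero hdeg)
    simp [coeff_C, coeff_X] at h1 h2
    exact ⟨h2, h1⟩
  · rintro ⟨rfl, rfl⟩
    simpa using hrest

end Asymptotics

open Polynomial in
theorem Matrix.charpoly_fin_two_eq_iff (M : Matrix (Fin 2) (Fin 2) ℂ) (k : ℂ) :
    M.charpoly = X ^ 2 - C k ↔ M 0 0 + M 1 1 = 0 ∧ M 0 0 * M 1 1 - M 0 1 * M 1 0 = -k := by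
  rw [Matrix.charpoly_fin_two, Matrix.trace_fin_two, Matrix.det_fin_two]
  constructor
  · intro h
    have h0 := congrArg (fun P : ℂ[X] => P.coeff 0) h
    have h1 := congrArg (fun P : ℂ[X] => P.coeff 1) h
    simp [coeff_X, coeff_C] at h0 h1
    exact ⟨by linear_combination -h1, h0⟩
  · rintro ⟨h1, h2⟩
    rw [h1, h2]
    simp [sub_eq_add_neg]

namespace ConnCoeffs

theorem mat_zero_zero (p : ConnCoeffs) (z : ℂ) :
    p.mat z 0 0 = p.a 0 + p.a 1 * z + p.a 2 * z ^ 2 := by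
  simp [mat, Fin.sum_univ_three]

theorem mat_zero_one (p : ConnCoeffs) (z : ℂ) :
    p.mat z 0 1 = p.c 0 + p.c 1 * z + p.c 2 * z ^ 2 + p.c 3 * z ^ 3 := by
  simp [mat, Fin.sum_univ_four]

theorem mat_one_zero (p : ConnCoeffs) (z : ℂ) : p.mat z 1 0 = p.b 0 + p.b 1 * z := by
  simp [mat, Fin.sum_univ_two]

theorem mat_one_one (p : ConnCoeffs) (z : ℂ) :
    p.mat z 1 1 = p.d 0 + p.d 1 * z + p.d 2 * z ^ 2 := by
  simp [mat, Fin.sum_univ_three]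

theorem ext_coeffs {p q : ConnCoeffs} (ha : ∀ i, p.a i = q.a i) (hb : ∀ i, p.b i = q.b i)
    (hc : ∀ i, p.c i = q.c i) (hd : ∀ i, p.d i = q.d i) (ht : p.t = q.t) : p = q := by
  cases p; cases q
  simp only [mk.injEq]
  exact ⟨funext ha, funext hb, funext hc, funext hd, ht⟩

end ConnCoeffs

open ConnCoeffs

open Polynomial in
theorem charpoly_coeff_isBigO_iff (p : ConnCoeffs) :
    (∀ i : ℕ, (fun z : ℂ => (p.matInfty z).charpoly.coeff i -
      (latticeInfty p.t z).charpoly.coeff i) =O[cobounded ℂ] (fun _ => (1 : ℂ))) ↔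
    (fun z : ℂ => (p.matInfty z).trace - (latticeInfty p.t z).trace)
      =O[cobounded ℂ] (fun _ => (1 : ℂ)) ∧
    (fun z : ℂ => (p.matInfty z).det - (latticeInfty p.t z).det)
      =O[cobounded ℂ] (fun _ => (1 : ℂ)) := by
  simp only [Matrix.charpoly_fin_two]
  constructor
  · intro h
    refine ⟨(h 1).neg_left.congr_left fun z => ?_, (h 0).congr_left fun z => ?_⟩
    · simp [coeff_C]
      ring
    · simp
  · rintro ⟨h1, h0⟩ i
    match i with
    | 0 => exact h0.congr_left fun z => by simp
    | 1 => exact h1.neg_left.congr_left fun z => by simp [coeff_C]; ring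
    | i + 2 =>
      refine (isBigO_zero _ _).congr_left fun z => ?_
      simp [coeff_X_pow]

theorem trace_infty_isBigO_iff (p : ConnCoeffs) :
    (fun z : ℂ => (p.matInfty z).trace - (latticeInfty p.t z).trace)
      =O[cobounded ℂ] (fun _ => (1 : ℂ)) ↔ p.a 2 + p.d 2 = 0 := by
  have h := isBigO_cobounded_one_iff 0 (p.a 2 + p.d 2)
    (p.a 1 + p.d 1 + 2 * (p.a 2 + p.d 2))
    (p.a 0 + p.d 0 + (p.a 1 + p.d 1) + (p.a 2 + p.d 2)) 0
  rw [eq_self, true_and] at h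
  rw [← h]
  refine isBigO_congr ?_ .rfl
  filter_upwards [eventually_ne_cobounded (1 : ℂ)] with z hz
  have hz' := sub_ne_zero.2 hz
  rw [Matrix.trace_fin_two, Matrix.trace_fin_two]
  simp only [matInfty, latticeInfty, Matrix.of_apply, Matrix.cons_val', Matrix.cons_val_zero,
    Matrix.cons_val_one, Matrix.cons_val_fin_one, mat_zero_zero, mat_one_one]
  field_simp
  ring

theorem det_infty_isBigO_iff (p : ConnCoeffs) (hd : ∀ i, p.d i = -p.a i) :
    (fun z : ℂ => (p.matInfty z).det - (latticeInfty p.t z).det)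
      =O[cobounded ℂ] (fun _ => (1 : ℂ)) ↔ p.a 2 ^ 2 + p.b 1 * p.c 3 = 0 ∧
      2 * p.a 1 * p.a 2 + p.b 0 * p.c 3 + p.b 1 * p.c 2 + p.a 2 = p.t ^ 2 := by
  -- Taylor coefficients at `z = 1` of the polynomials `a`, `b`, `c`.
  obtain ⟨A₀, hA₀⟩ : ∃ A₀, A₀ = p.a 0 + p.a 1 + p.a 2 := ⟨_, rfl⟩
  obtain ⟨A₁, hA₁⟩ : ∃ A₁, A₁ = p.a 1 + 2 * p.a 2 := ⟨_, rfl⟩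
  obtain ⟨B₀, hB₀⟩ : ∃ B₀, B₀ = p.b 0 + p.b 1 := ⟨_, rfl⟩
  obtain ⟨C₀, hC₀⟩ : ∃ C₀, C₀ = p.c 0 + p.c 1 + p.c 2 + p.c 3 := ⟨_, rfl⟩
  obtain ⟨C₁, hC₁⟩ : ∃ C₁, C₁ = p.c 1 + 2 * p.c 2 + 3 * p.c 3 := ⟨_, rfl⟩
  obtain ⟨C₂, hC₂⟩ : ∃ C₂, C₂ = p.c 2 + 3 * p.c 3 := ⟨_, rfl⟩
  have h := isBigO_cobounded_one_iff (p.a 2 ^ 2 + p.b 1 * p.c 3)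
    (2 * p.a 2 * A₁ + p.b 1 * C₂ + B₀ * p.c 3 + p.a 2 - p.t ^ 2)
    (A₁ ^ 2 + 2 * p.a 2 * A₀ + p.b 1 * C₁ + B₀ * C₂ + A₁ - p.t ^ 2 + 3 / 16)
    (2 * A₀ * A₁ + p.b 1 * C₀ + B₀ * C₁ + A₀) (A₀ ^ 2 + B₀ * C₀)
  have h' : (p.a 2 ^ 2 + p.b 1 * p.c 3 = 0 ∧
      2 * p.a 1 * p.a 2 + p.b 0 * p.c 3 + p.b 1 * p.c 2 + p.a 2 = p.t ^ 2) ↔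
      (p.a 2 ^ 2 + p.b 1 * p.c 3 = 0 ∧
      2 * p.a 2 * A₁ + p.b 1 * C₂ + B₀ * p.c 3 + p.a 2 - p.t ^ 2 = 0) := by
    refine and_congr_right fun h0 => ?_
    rw [← sub_eq_zero]
    have : 2 * p.a 2 * A₁ + p.b 1 * C₂ + B₀ * p.c 3 + p.a 2 - p.t ^ 2 =
      2 * p.a 1 * p.a 2 + p.b 0 * p.c 3 + p.b 1 * p.c 2 + p.a 2 - p.t ^ 2 := by
      rw [hA₁, hC₂, hB₀]
      linear_combination 4 * h0
    rw [this]
  rw [h', ← h, ← isBigO_neg_left]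
  refine isBigO_congr ?_ .rfl
  filter_upwards [eventually_ne_cobounded (1 : ℂ), eventually_ne_cobounded (0 : ℂ)] with z hz hz0
  rw [Matrix.det_fin_two, Matrix.det_fin_two]
  simp only [matInfty, latticeInfty, Matrix.of_apply, Matrix.cons_val', Matrix.cons_val_zero,
    Matrix.cons_val_one, Matrix.cons_val_fin_one, mat_zero_zero, mat_one_one, mat_zero_one,
    mat_one_zero, hd]
  obtain ⟨y, rfl⟩ : ∃ y, z = y + 1 := ⟨z - 1, by ring⟩
  have hy : y ≠ 0 := fun h => hz (by rw [h, zero_add])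
  rw [hA₀, hA₁, hB₀, hC₀, hC₁, hC₂]
  simp only [add_sub_cancel_right]
  field_simp
  ring

/-- The trace `a + d` has degree at most `2`. It vanishes at `0` and `1`, and boundedness at
infinity removes its `z²` term, so `d = -a`. The remaining equations are the determinant conditions.
-/
theorem isAdmissible_iff {θ₀ θ₁ : ℂ} {p : ConnCoeffs} :
    IsAdmissible θ₀ θ₁ p ↔ p.t ≠ 0 ∧ (p.b 0 ≠ 0 ∨ p.b 1 ≠ 0) ∧ (∀ i, p.d i = -p.a i) ∧
      p.a 0 ^ 2 + p.b 0 * p.c 0 = θ₀ ^ 2 / 4 ∧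
      (p.a 0 + p.a 1 + p.a 2) ^ 2 +
        (p.b 0 + p.b 1) * (p.c 0 + p.c 1 + p.c 2 + p.c 3) = θ₁ ^ 2 / 4 ∧
      p.a 2 ^ 2 + p.b 1 * p.c 3 = 0 ∧
      2 * p.a 1 * p.a 2 + p.b 0 * p.c 3 + p.b 1 * p.c 2 + p.a 2 = p.t ^ 2 := by
  have hb : p.b ≠ 0 ↔ (p.b 0 ≠ 0 ∨ p.b 1 ≠ 0) := by
    rw [Ne, funext_iff, Fin.forall_fin_two, Pi.zero_apply, Pi.zero_apply]
    tauto
  have h0 := Matrix.charpoly_fin_two_eq_iff (((0 : ℂ) - 1)⁻¹ • p.mat 0) (θ₀ ^ 2 / 4)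
  have h1 := Matrix.charpoly_fin_two_eq_iff ((1 : ℂ)⁻¹ • p.mat 1) (θ₁ ^ 2 / 4)
  simp only [Matrix.smul_apply, mat_zero_zero, mat_one_one, mat_zero_one, mat_one_zero,
    smul_eq_mul] at h0 h1
  constructor
  · rintro ⟨ht, hb', hz, ho, hi⟩
    rw [charpoly_coeff_isBigO_iff, trace_infty_isBigO_iff] at hi
    obtain ⟨hz1, hz2⟩ := h0.1 hz
    obtain ⟨ho1, ho2⟩ := h1.1 ho
    norm_num at hz1 hz2 ho1 ho2
    have hd : ∀ i, p.d i = -p.a i := by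
      intro i
      fin_cases i
      · change p.d 0 = -p.a 0
        linear_combination -hz1
      · change p.d 1 = -p.a 1
        linear_combination hz1 + ho1 - hi.1
      · change p.d 2 = -p.a 2
        linear_combination hi.1
    rw [det_infty_isBigO_iff p hd] at hi
    rw [hd] at hz2
    rw [hd, hd, hd] at ho2
    exact ⟨ht, hb.1 hb', hd, by linear_combination -hz2, by linear_combination -ho2, hi.2⟩
  · rintro ⟨ht, hb', hd, hz, ho, hi⟩
    refine ⟨ht, hb.2 hb', h0.2 ⟨?_, ?_⟩, h1.2 ⟨?_, ?_⟩, ?_⟩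
    · rw [hd, hd, hd]; ring
    · rw [hd, hd, hd]; norm_num; linear_combination -hz
    · rw [hd, hd, hd]; ring
    · rw [hd, hd, hd]; norm_num; linear_combination -ho
    · rw [charpoly_coeff_isBigO_iff, trace_infty_isBigO_iff, det_infty_isBigO_iff p hd]
      exact ⟨by rw [hd]; ring, hi⟩

/-! ### The group action on coefficients -/

noncomputable section

namespace ConnCoeffs

/-- The coefficients of `p` after the bundle automorphism `e₁ ↦ l e₁`, `e₂ ↦ e₂ + (x + y z) e₁`. -/
def transform (l x y : ℂ) (p : ConnCoeffs) : ConnCoeffs where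
  a := ![p.a 0 - x * p.b 0, p.a 1 - x * p.b 1 - y * p.b 0, p.a 2 - y * p.b 1]
  b := ![l * p.b 0, l * p.b 1]
  c := ![(p.c 0 + x * (p.a 0 - p.d 0) - x ^ 2 * p.b 0) / l,
    (p.c 1 + x * (p.a 1 - p.d 1) + y * (p.a 0 - p.d 0) - x ^ 2 * p.b 1
      - 2 * x * y * p.b 0 - y) / l,
    (p.c 2 + x * (p.a 2 - p.d 2) + y * (p.a 1 - p.d 1) - 2 * x * y * p.b 1
      - y ^ 2 * p.b 0 + y) / l,
    (p.c 3 + y * (p.a 2 - p.d 2) - y ^ 2 * p.b 1) / l]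
  d := ![p.d 0 + x * p.b 0, p.d 1 + x * p.b 1 + y * p.b 0, p.d 2 + y * p.b 1]
  t := p.t

theorem transform_one_zero_zero (p : ConnCoeffs) : p.transform 1 0 0 = p := by
  refine ext_coeffs ?_ ?_ ?_ ?_ rfl <;> intro i <;> fin_cases i <;> simp [transform]

theorem gaugeEquiv_iff {p q : ConnCoeffs} :
    GaugeEquiv p q ↔ ∃ l x y : ℂ, l ≠ 0 ∧ q = p.transform l x y := by
  have key : ∀ l x y z : ℂ, gaugeMat l x y z * q.mat z =
      p.mat z * gaugeMat l x y z + (z * (z - 1)) • gaugeMatDeriv y ↔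
      (l * q.mat z 0 0 + (x + y * z) * q.mat z 1 0 = p.mat z 0 0 * l ∧
        l * q.mat z 0 1 + (x + y * z) * q.mat z 1 1 =
          p.mat z 0 0 * (x + y * z) + p.mat z 0 1 + z * (z - 1) * y) ∧
      q.mat z 1 0 = p.mat z 1 0 * l ∧
        q.mat z 1 1 = p.mat z 1 0 * (x + y * z) + p.mat z 1 1 := fun l x y z => by
    rw [← Matrix.ext_iff, Fin.forall_fin_two, Fin.forall_fin_two, Fin.forall_fin_two]
    simp [gaugeMat, gaugeMatDeriv, Matrix.mul_apply, Fin.sum_univ_two]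
  constructor
  · rintro ⟨ht, l, x, y, hl, h⟩
    refine ⟨l, x, y, hl, ?_⟩
    simp only [key, mat_zero_zero, mat_one_one, mat_zero_one, mat_one_zero] at h
    -- The identities are polynomial in `z` of degree at most `3` once `b` and `d` are known, so
    -- four values determine the coefficients.
    obtain ⟨⟨a0, c0⟩, b0, d0⟩ := h 0
    obtain ⟨⟨a1, c1⟩, b1, d1⟩ := h 1
    obtain ⟨⟨a2, c2⟩, b2, d2⟩ := h (-1)
    obtain ⟨⟨a3, c3⟩, b3, d3⟩ := h 2
    have hb0 : q.b 0 = l * p.b 0 := by linear_combination b0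
    have hb1 : q.b 1 = l * p.b 1 := by linear_combination b1 - b0
    have hd0 : q.d 0 = p.d 0 + x * p.b 0 := by linear_combination d0
    have hd1 : q.d 1 = p.d 1 + x * p.b 1 + y * p.b 0 := by linear_combination (d1 - d2) / 2
    have hd2 : q.d 2 = p.d 2 + y * p.b 1 := by linear_combination (d1 + d2) / 2 - d0
    rw [hb0, hb1] at a0 a1 a2
    rw [hd0, hd1, hd2] at c0 c1 c2 c3
    refine ext_coeffs ?_ ?_ ?_ ?_ ht <;> intro i <;> fin_cases i
    · exact mul_left_cancel₀ hl (by simp [transform, -mul_eq_mul_left_iff]; linear_combination a0)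
    · exact mul_left_cancel₀ hl (by simp [transform, -mul_eq_mul_left_iff]; linear_combination (a1 - a2) / 2)
    · exact mul_left_cancel₀ hl (by simp [transform, -mul_eq_mul_left_iff]; linear_combination (a1 + a2) / 2 - a0)
    · exact hb0
    · exact hb1
    · exact (eq_div_iff hl).2 (by simp; linear_combination c0)
    · exact (eq_div_iff hl).2 (by
        simp; linear_combination c1 - c0 / 2 - c2 / 3 - c3 / 6)
    · exact (eq_div_iff hl).2 (by simp; linear_combination (c1 + c2) / 2 - c0)
    · exact (eq_div_iff hl).2 (by
        simp; linear_combination c0 / 2 - c1 / 2 - c2 / 6 + c3 / 6)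
    · exact hd0
    · exact hd1
    · exact hd2
  · rintro ⟨l, x, y, hl, rfl⟩
    refine ⟨rfl, l, x, y, hl, fun z => (key l x y z).2 ?_⟩
    simp only [mat_zero_zero, mat_one_one, mat_zero_one, mat_one_zero]
    simp [transform]
    refine ⟨⟨by ring, ?_⟩, by ring, by ring⟩
    field_simp
    ring

end ConnCoeffs

theorem IsAdmissible.of_gaugeEquiv {θ₀ θ₁ : ℂ} {p q : ConnCoeffs} (hp : IsAdmissible θ₀ θ₁ p)
    (h : GaugeEquiv p q) : IsAdmissible θ₀ θ₁ q := by
  obtain ⟨l, x, y, hl, rfl⟩ := gaugeEquiv_iff.1 h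
  obtain ⟨ht, hb, hd, h0, h1, h2, h3⟩ := isAdmissible_iff.1 hp
  refine isAdmissible_iff.2 ⟨ht, ?_, ?_, ?_, ?_, ?_, ?_⟩
  · simpa [transform, hl] using hb
  · intro i
    fin_cases i <;> simp [transform, hd] <;> ring
  · simp [transform, hd]
    field_simp
    linear_combination 4 * h0
  · simp [transform, hd]
    field_simp
    linear_combination 4 * h1
  · simp [transform, hd]
    field_simp
    linear_combination h2
  · simp [transform, hd]
    field_simp
    linear_combination h3

end

/-! ### Normal forms -/

noncomputable section

namespace ConnCoeffs

theorem continuous_toProd :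
    Continuous (fun p : ConnCoeffs => (p.a, p.b, p.c, p.d, p.t)) :=
  continuous_induced_dom

@[fun_prop]
theorem continuous_a : Continuous ConnCoeffs.a :=
  continuous_toProd.fst

@[fun_prop]
theorem continuous_b : Continuous ConnCoeffs.b :=
  continuous_toProd.snd.fst

@[fun_prop]
theorem continuous_c : Continuous ConnCoeffs.c :=
  continuous_toProd.snd.snd.fst

@[fun_prop]
theorem continuous_d : Continuous ConnCoeffs.d :=
  continuous_toProd.snd.snd.snd.fst

@[fun_prop]
theorem continuous_t : Continuous ConnCoeffs.t :=
  continuous_toProd.snd.snd.snd.snd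

theorem continuousOn_of_coeffs {X : Type*} [TopologicalSpace X] {f : X → ConnCoeffs} {s : Set X}
    (ha : ∀ i, ContinuousOn (fun x => (f x).a i) s) (hb : ∀ i, ContinuousOn (fun x => (f x).b i) s)
    (hc : ∀ i, ContinuousOn (fun x => (f x).c i) s) (hd : ∀ i, ContinuousOn (fun x => (f x).d i) s)
    (ht : ContinuousOn (fun x => (f x).t) s) : ContinuousOn f s := by
  rw [continuousOn_iff_continuous_domRestrict] at ht ⊢
  refine continuous_induced_rng.2 (.prodMk ?_ (.prodMk ?_ (.prodMk ?_ (.prodMk ?_ ht)))) <;>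
    refine continuous_pi fun i => ?_
  · exact continuousOn_iff_continuous_domRestrict.1 (ha i)
  · exact continuousOn_iff_continuous_domRestrict.1 (hb i)
  · exact continuousOn_iff_continuous_domRestrict.1 (hc i)
  · exact continuousOn_iff_continuous_domRestrict.1 (hd i)

theorem continuousOn_transform {s : Set ConnCoeffs} {l x y : ConnCoeffs → ℂ}
    (hl : ContinuousOn l s) (hx : ContinuousOn x s) (hy : ContinuousOn y s)
    (hl0 : ∀ p ∈ s, l p ≠ 0) : ContinuousOn (fun p => p.transform (l p) (x p) (y p)) s := by
  refine continuousOn_of_coeffs ?_ ?_ ?_ ?_ continuous_t.continuousOn <;> intro i <;>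
    fin_cases i <;> simp [transform] <;> fun_prop (disch := assumption)

/-- The normal form with `b₁ = 1` and constant `a`. -/
def normalizeFst (p : ConnCoeffs) : ConnCoeffs :=
  p.transform (p.b 1)⁻¹ ((p.a 1 - p.a 2 / p.b 1 * p.b 0) / p.b 1) (p.a 2 / p.b 1)

/-- The normal form with `b₀ = 1` and `a` a multiple of `z²`. -/
def normalizeSnd (p : ConnCoeffs) : ConnCoeffs :=
  p.transform (p.b 0)⁻¹ (p.a 0 / p.b 0) ((p.a 1 - p.a 0 / p.b 0 * p.b 1) / p.b 0)

theorem gaugeEquiv_normalizeFst {p : ConnCoeffs} (h : p.b 1 ≠ 0) :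
    GaugeEquiv p p.normalizeFst :=
  gaugeEquiv_iff.2 ⟨_, _, _, inv_ne_zero h, rfl⟩

theorem gaugeEquiv_normalizeSnd {p : ConnCoeffs} (h : p.b 0 ≠ 0) :
    GaugeEquiv p p.normalizeSnd :=
  gaugeEquiv_iff.2 ⟨_, _, _, inv_ne_zero h, rfl⟩

theorem normalizeFst_spec {p : ConnCoeffs} (h : p.b 1 ≠ 0) :
    p.normalizeFst.b 1 = 1 ∧ p.normalizeFst.a 1 = 0 ∧ p.normalizeFst.a 2 = 0 := by
  refine ⟨?_, ?_, ?_⟩ <;> simp [normalizeFst, transform] <;> field_simp <;> ring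

theorem normalizeSnd_spec {p : ConnCoeffs} (h : p.b 0 ≠ 0) :
    p.normalizeSnd.b 0 = 1 ∧ p.normalizeSnd.a 0 = 0 ∧ p.normalizeSnd.a 1 = 0 := by
  refine ⟨?_, ?_, ?_⟩ <;> simp [normalizeSnd, transform] <;> field_simp <;> ring

theorem normalizeFst_of_spec {p : ConnCoeffs} (h : p.b 1 = 1 ∧ p.a 1 = 0 ∧ p.a 2 = 0) :
    p.normalizeFst = p := by
  simp [normalizeFst, h, transform_one_zero_zero]

theorem normalizeSnd_of_spec {p : ConnCoeffs} (h : p.b 0 = 1 ∧ p.a 0 = 0 ∧ p.a 1 = 0) :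
    p.normalizeSnd = p := by
  simp [normalizeSnd, h, transform_one_zero_zero]

/-- An automorphism between two normal forms is trivial: `b₁ = 1` forces `l = 1`, then `a₂ = 0`
forces `y = 0`, and `a₁ = 0` forces `x = 0`. -/
theorem normalizeFst_eq_of_gaugeEquiv {p q : ConnCoeffs} (h : GaugeEquiv p q) (hp : p.b 1 ≠ 0) :
    q.b 1 ≠ 0 ∧ p.normalizeFst = q.normalizeFst := by
  have hq : q.b 1 ≠ 0 := by
    obtain ⟨l, x, y, hl, rfl⟩ := gaugeEquiv_iff.1 h
    simpa [transform] using ⟨hl, hp⟩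
  refine ⟨hq, ?_⟩
  have hs := normalizeFst_spec hp
  have hs' := normalizeFst_spec hq
  obtain ⟨l, x, y, hl, he⟩ := gaugeEquiv_iff.1
    ((gaugeEquiv_normalizeFst hp).symm.trans (h.trans (gaugeEquiv_normalizeFst hq)))
  rw [he] at hs' ⊢
  simp [transform, hs] at hs'
  obtain ⟨rfl, h1, rfl⟩ := hs'
  obtain rfl : x = 0 := by simpa using h1
  rw [transform_one_zero_zero]

theorem normalizeSnd_eq_of_gaugeEquiv {p q : ConnCoeffs} (h : GaugeEquiv p q) (hp : p.b 0 ≠ 0) :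
    q.b 0 ≠ 0 ∧ p.normalizeSnd = q.normalizeSnd := by
  have hq : q.b 0 ≠ 0 := by
    obtain ⟨l, x, y, hl, rfl⟩ := gaugeEquiv_iff.1 h
    simpa [transform] using ⟨hl, hp⟩
  refine ⟨hq, ?_⟩
  have hs := normalizeSnd_spec hp
  have hs' := normalizeSnd_spec hq
  obtain ⟨l, x, y, hl, he⟩ := gaugeEquiv_iff.1
    ((gaugeEquiv_normalizeSnd hp).symm.trans (h.trans (gaugeEquiv_normalizeSnd hq)))
  rw [he] at hs' ⊢
  simp [transform, hs] at hs'
  obtain ⟨rfl, rfl, h1⟩ := hs'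
  obtain rfl : y = 0 := by simpa using h1
  rw [transform_one_zero_zero]

theorem continuousOn_normalizeFst : ContinuousOn normalizeFst {p | p.b 1 ≠ 0} := by
  have h : ∀ p ∈ {p : ConnCoeffs | p.b 1 ≠ 0}, p.b 1 ≠ 0 := fun p hp => hp
  refine continuousOn_transform ?_ ?_ ?_ fun p hp => inv_ne_zero hp <;>
    fun_prop (disch := assumption)

theorem continuousOn_normalizeSnd : ContinuousOn normalizeSnd {p | p.b 0 ≠ 0} := by
  have h : ∀ p ∈ {p : ConnCoeffs | p.b 0 ≠ 0}, p.b 0 ≠ 0 := fun p hp => hp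
  refine continuousOn_transform ?_ ?_ ?_ fun p hp => inv_ne_zero hp <;>
    fun_prop (disch := assumption)

end ConnCoeffs

/-! ### Charts on the quotient -/

namespace ModuliSpace

variable {θ₀ θ₁ : ℂ}

/-- A representative of a class of connections. -/
def rep (m : ModuliSpace θ₀ θ₁) : ConnSpace θ₀ θ₁ := Quotient.out m

theorem mk_rep (m : ModuliSpace θ₀ θ₁) : mk m.rep = m := Quotient.out_eq m

theorem gaugeEquiv_rep_mk (p : ConnSpace θ₀ θ₁) : GaugeEquiv p.1 (mk p).rep.1 :=
  GaugeEquiv.symm (Quotient.mk_out (s := gaugeSetoid θ₀ θ₁) p)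

theorem mk_eq {p q : ConnSpace θ₀ θ₁} (h : GaugeEquiv p.1 q.1) : mk p = mk q :=
  Quotient.sound (s := gaugeSetoid θ₀ θ₁) h

theorem t_mk (p : ConnSpace θ₀ θ₁) : (mk p).t = p.1.t := rfl

theorem isQuotientMap_mk : Topology.IsQuotientMap (mk (θ₀ := θ₀) (θ₁ := θ₁)) :=
  isQuotientMap_quotient_mk'

theorem isOpen_rep_mem {O : Set ConnCoeffs} (hO : IsOpen O)
    (hinv : ∀ p q, GaugeEquiv p q → p ∈ O → q ∈ O) :
    IsOpen {m : ModuliSpace θ₀ θ₁ | m.rep.1 ∈ O} := by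
  rw [← isQuotientMap_mk.isOpen_preimage]
  convert hO.preimage continuous_subtype_val using 1
  ext p
  exact ⟨hinv _ _ (gaugeEquiv_rep_mk p).symm, hinv _ _ (gaugeEquiv_rep_mk p)⟩

/-- The choice `rep` need not be continuous, but an invariant does not see it: `N` descends to the
quotient, and continuity is tested upstairs because the domain is open. -/
theorem continuousOn_rep {Z : Type*} [TopologicalSpace Z] {O : Set ConnCoeffs} (hO : IsOpen O)
    {N : ConnCoeffs → Z} (hN : ContinuousOn N O)
    (hinv : ∀ p q, GaugeEquiv p q → p ∈ O → q ∈ O ∧ N p = N q) :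
    ContinuousOn (fun m : ModuliSpace θ₀ θ₁ => N m.rep.1) {m | m.rep.1 ∈ O} := by
  rw [isQuotientMap_mk.continuousOn_isOpen_iff
    (isOpen_rep_mem hO fun p q h hp => (hinv p q h hp).1)]
  have h : ∀ p ∈ mk (θ₀ := θ₀) (θ₁ := θ₁) ⁻¹' {m | m.rep.1 ∈ O}, p.1 ∈ O ∧ N (mk p).rep.1 = N p.1 :=
    fun p hp => hinv _ _ (gaugeEquiv_rep_mk p).symm hp
  refine ContinuousOn.congr (f := fun p : ConnSpace θ₀ θ₁ => N p.1) ?_ fun p hp => (h p hp).2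
  exact hN.comp continuous_subtype_val.continuousOn fun p hp => (h p hp).1

/-- The locus in the moduli space that is described by the values of an invariant `N` in `Y`. -/
def chartDomain {Z : Type*} (θ₀ θ₁ a : ℂ) (O : Set ConnCoeffs) (N : ConnCoeffs → Z) (Y : Set Z) :
    Set (ModuliSpace θ₀ θ₁) :=
  {m | m.t = a ∧ m.rep.1 ∈ O ∧ N m.rep.1 ∈ Y}

/-- A continuous slice `sl` and a continuous invariant `N` induce mutually inverse maps between `Y`
and its part of the quotient. -/
theorem nonempty_homeomorph_chartDomain {Z : Type*} [TopologicalSpace Z] {a : ℂ}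
    {O : Set ConnCoeffs} {Y : Set Z} {N : ConnCoeffs → Z} {sl : Z → ConnCoeffs} (hO : IsOpen O)
    (hN : ContinuousOn N O)
    (hinv : ∀ p q, GaugeEquiv p q → p ∈ O → q ∈ O ∧ N p = N q)
    (hsl : ContinuousOn sl Y)
    (hadm : ∀ y ∈ Y, IsAdmissible θ₀ θ₁ (sl y) ∧ (sl y).t = a ∧ sl y ∈ O ∧ N (sl y) = y)
    (hback : ∀ p, IsAdmissible θ₀ θ₁ p → p.t = a → p ∈ O → N p ∈ Y → GaugeEquiv p (sl (N p))) :
    Nonempty (Y ≃ₜ chartDomain θ₀ θ₁ a O N Y) := by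
  have hmk : ∀ y (hy : y ∈ Y), (mk ⟨sl y, (hadm y hy).1⟩ : ModuliSpace θ₀ θ₁).rep.1 ∈ O ∧
      N (mk ⟨sl y, (hadm y hy).1⟩ : ModuliSpace θ₀ θ₁).rep.1 = y := fun y hy => by
    obtain ⟨h1, h2⟩ := hinv _ _ (gaugeEquiv_rep_mk ⟨sl y, (hadm y hy).1⟩) (hadm y hy).2.2.1
    exact ⟨h1, h2.symm.trans (hadm y hy).2.2.2⟩
  refine ⟨{
    toFun := fun y => ⟨mk ⟨sl y, (hadm y y.2).1⟩, (hadm y y.2).2.1, (hmk y y.2).1,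
      (hmk y y.2).2.symm ▸ y.2⟩
    invFun := fun m => ⟨N m.1.rep.1, m.2.2.2⟩
    left_inv := fun y => Subtype.ext (hmk y y.2).2
    right_inv := fun m => Subtype.ext ?_
    continuous_toFun := ?_
    continuous_invFun := ?_ }⟩
  · conv_rhs => rw [← mk_rep m.1]
    refine mk_eq (GaugeEquiv.symm (hback _ m.1.rep.2 ?_ m.2.2.1 m.2.2.2))
    rw [← t_mk, mk_rep, m.2.1]
  · exact (isQuotientMap_mk.continuous.comp
      ((continuousOn_iff_continuous_domRestrict.1 hsl).subtype_mk _)).subtype_mk _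
  · refine Continuous.subtype_mk ?_ _
    exact (continuousOn_rep hO hN hinv).comp_continuous continuous_subtype_val fun m => m.2.2.1

end ModuliSpace

open ModuliSpace

/-! ### The first affine part and its coordinates -/

theorem mem_firstAffinePart_iff {θ₀ θ₁ : ℂ} {m : ModuliSpace θ₀ θ₁} :
    m ∈ firstAffinePart θ₀ θ₁ ↔ m.rep.1.b 1 ≠ 0 := by
  constructor
  · rintro ⟨p, hp, rfl⟩
    exact (normalizeFst_eq_of_gaugeEquiv (gaugeEquiv_rep_mk p) hp).1
  · exact fun h => ⟨m.rep, h, mk_rep m⟩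

theorem isOpen_b_ne_zero (i : Fin 2) : IsOpen {p : ConnCoeffs | p.b i ≠ 0} :=
  isOpen_ne_fun (by fun_prop) (by fun_prop)

theorem isOpen_firstAffinePart (θ₀ θ₁ : ℂ) : IsOpen (firstAffinePart θ₀ θ₁) := by
  convert isOpen_rep_mem (isOpen_b_ne_zero 1)
    fun p q h hp => (normalizeFst_eq_of_gaugeEquiv h hp).1 using 1
  ext m
  exact mem_firstAffinePart_iff

namespace ConnCoeffs

/-- The coordinates on the first affine part. -/
def coordsFst (p : ConnCoeffs) : ℂ × ℂ × ℂ × ℂ :=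
  (-p.normalizeFst.b 0, p.normalizeFst.a 0, p.normalizeFst.c 0,
    -(p.normalizeFst.c 0 + p.normalizeFst.c 1 + p.normalizeFst.c 2 + p.normalizeFst.c 3))

/-- The connection in normal form with given coordinates on the first affine part. -/
def sliceFst (a : ℂ) (x : ℂ × ℂ × ℂ × ℂ) : ConnCoeffs where
  a := ![x.2.1, 0, 0]
  b := ![-x.1, 1]
  c := ![x.2.2.1, -x.2.2.2 - x.2.2.1 - a ^ 2, a ^ 2, 0]
  d := ![-x.2.1, 0, 0]
  t := a

/-- The coordinates near the locus `b₁ = 0`. -/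
def coordsSnd (p : ConnCoeffs) : ℂ × ℂ :=
  (p.normalizeSnd.a 2 / p.normalizeSnd.c 3, p.normalizeSnd.c 2)

/-- The leading coefficient of `c` in normal form, as a function of the coordinates near the locus
`b₁ = 0`. -/
def leadSnd (a : ℂ) (x : ℂ × ℂ) : ℂ := a ^ 2 / (1 + x.1 - x.1 ^ 2 * x.2)

/-- The connection in normal form with given coordinates near the locus `b₁ = 0`. -/
def sliceSnd (θ₀ θ₁ a : ℂ) (x : ℂ × ℂ) : ConnCoeffs where
  a := ![0, 0, x.1 * leadSnd a x]
  b := ![1, -x.1 ^ 2 * leadSnd a x]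
  c := ![θ₀ ^ 2 / 4, (θ₁ ^ 2 / 4 - (x.1 * leadSnd a x) ^ 2) / (1 - x.1 ^ 2 * leadSnd a x)
    - θ₀ ^ 2 / 4 - x.2 - leadSnd a x, x.2, leadSnd a x]
  d := ![0, 0, -(x.1 * leadSnd a x)]
  t := a

end ConnCoeffs

theorem nonempty_homeomorph_chartFst (θ₀ θ₁ a : ℂ) (ha : a ≠ 0) :
    Nonempty (biconicSurface (θ₀ ^ 2 / 4) (θ₁ ^ 2 / 4) ≃ₜ
      chartDomain θ₀ θ₁ a {p | p.b 1 ≠ 0} coordsFst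
        (biconicSurface (θ₀ ^ 2 / 4) (θ₁ ^ 2 / 4))) := by
  refine nonempty_homeomorph_chartDomain (sl := sliceFst a) (isOpen_b_ne_zero 1) ?_ ?_ ?_ ?_ ?_
  · have h : Continuous fun r : ConnCoeffs =>
        (-r.b 0, r.a 0, r.c 0, -(r.c 0 + r.c 1 + r.c 2 + r.c 3)) := by fun_prop
    exact h.comp_continuousOn continuousOn_normalizeFst
  · intro p q h hp
    obtain ⟨h1, h2⟩ := normalizeFst_eq_of_gaugeEquiv h hp
    exact ⟨h1, by rw [coordsFst, h2, coordsFst]⟩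
  · refine continuousOn_of_coeffs ?_ ?_ ?_ ?_ continuousOn_const <;> intro i <;>
      fin_cases i <;> simp [sliceFst] <;> fun_prop
  · rintro ⟨q, p, u, v⟩ ⟨h1, h2⟩
    simp only at h1 h2
    refine ⟨isAdmissible_iff.2 ⟨ha, Or.inr ?_, ?_, ?_, ?_, ?_, ?_⟩, rfl, ?_, ?_⟩
    · simp [sliceFst]
    · intro i
      fin_cases i <;> simp [sliceFst]
    · simp [sliceFst]
      linear_combination -h1
    · simp [sliceFst]
      linear_combination -h2
    · simp [sliceFst]
    · simp [sliceFst]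
    · simp [sliceFst]
    · rw [coordsFst, normalizeFst_of_spec (by simp [sliceFst])]
      simp [sliceFst]
      ring
  · intro p hp ht hb _
    have hg := gaugeEquiv_normalizeFst hb
    obtain ⟨hb1, ha1, ha2⟩ := normalizeFst_spec hb
    obtain ⟨-, -, hd, h0, h1, h2, h3⟩ := isAdmissible_iff.1 (hp.of_gaugeEquiv hg)
    have ht' : p.normalizeFst.t = a := hg.1.trans ht
    have hc3 : p.normalizeFst.c 3 = 0 := by simpa [hb1, ha2] using h2
    have hc2 : p.normalizeFst.c 2 = a ^ 2 := by simpa [hb1, ha2, hc3, ht'] using h3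
    convert hg using 1
    have hc1 : p.normalizeFst.c 0 + p.normalizeFst.c 1 + a ^ 2 - p.normalizeFst.c 0 - a ^ 2 =
        p.normalizeFst.c 1 := by ring
    refine ext_coeffs ?_ ?_ ?_ ?_ ht'.symm <;> intro i <;> fin_cases i <;>
      simp [sliceFst, coordsFst, hb1, ha1, ha2, hd, hc3, hc2, hc1]

/-! ### The chart around the locus `b₁ = 0` -/

/-- A star-shaped neighbourhood of the line `σ = 0`. -/
def lineNhd (a : ℂ) : Set (ℂ × ℂ) := {x | 4 * ‖x.1‖ * (1 + ‖x.2‖ + ‖a‖ ^ 2) < 1}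

theorem isOpen_lineNhd (a : ℂ) : IsOpen (lineNhd a) :=
  isOpen_lt (by fun_prop) (by fun_prop)

theorem isSimplyConnected_lineNhd (a : ℂ) : IsSimplyConnected (lineNhd a) := by
  refine StarConvex.isSimplyConnected (x := 0) ?_ ⟨0, by simp [lineNhd]⟩
  rw [starConvex_zero_iff]
  intro x hx l hl0 hl1
  have hx' : 4 * ‖x.1‖ * (1 + ‖x.2‖ + ‖a‖ ^ 2) < 1 := hx
  refine lt_of_le_of_lt ?_ hx'
  simp only [Prod.smul_fst, Prod.smul_snd, norm_smul, Real.norm_of_nonneg hl0]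
  have h1 : l * ‖x.1‖ ≤ ‖x.1‖ := mul_le_of_le_one_left (norm_nonneg _) hl1
  have h2 : l * ‖x.2‖ ≤ ‖x.2‖ := mul_le_of_le_one_left (norm_nonneg _) hl1
  gcongr

/-- For each `c` the slice is a punctured disc, covered by the left half-plane via the exponential
rescaled by the radius. -/
theorem isPathConnected_lineNhd_diff (a : ℂ) : IsPathConnected (lineNhd a ∩ {x | x.1 ≠ 0}) := by
  have hpos : ∀ c : ℂ, 0 < 4 * (1 + ‖c‖ + ‖a‖ ^ 2) := fun c => by positivity
  have hne : ∀ c : ℂ, ((4 * (1 + ‖c‖ + ‖a‖ ^ 2) : ℝ) : ℂ) ≠ 0 := fun c =>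
    Complex.ofReal_ne_zero.2 (hpos c).ne'
  have hH : IsPathConnected {z : ℂ | z.re < 0} :=
    (convex_halfSpace_re_lt 0).isPathConnected ⟨-1, by simp⟩
  have h := (hH.prod (isPathConnected_univ (X := ℂ))).image
    (f := fun x : ℂ × ℂ => (Complex.exp x.1 / ((4 * (1 + ‖x.2‖ + ‖a‖ ^ 2) : ℝ) : ℂ), x.2))
    (Continuous.prodMk (Continuous.div (by fun_prop) (by fun_prop) fun x => hne x.2) (by fun_prop))
  convert h using 1
  ext ⟨σ, c⟩
  constructor
  · rintro ⟨h1, h2⟩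
    have h1' : 4 * ‖σ‖ * (1 + ‖c‖ + ‖a‖ ^ 2) < 1 := h1
    have h2' : σ ≠ 0 := h2
    refine ⟨(Complex.log (σ * ((4 * (1 + ‖c‖ + ‖a‖ ^ 2) : ℝ) : ℂ)), c), ⟨?_, mem_univ _⟩, ?_⟩
    · change (Complex.log _).re < 0
      rw [Complex.log_re]
      refine Real.log_neg (norm_pos_iff.2 (mul_ne_zero h2' (hne c))) ?_
      rw [norm_mul, Complex.norm_real, Real.norm_of_nonneg (hpos c).le]
      linarith
    · simp only [Prod.mk.injEq, and_true]
      rw [Complex.exp_log (mul_ne_zero h2' (hne c)), mul_div_cancel_right₀ _ (hne c)]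
  · rintro ⟨⟨z, c⟩, ⟨hz, -⟩, h⟩
    simp only [Prod.mk.injEq] at h
    obtain ⟨rfl, rfl⟩ := h
    refine ⟨?_, div_ne_zero (Complex.exp_ne_zero z) (hne c)⟩
    change 4 * ‖_‖ * _ < (1 : ℝ)
    rw [norm_div, Complex.norm_real, Real.norm_of_nonneg (hpos c).le, Complex.norm_exp]
    have : 4 * (Real.exp z.re / (4 * (1 + ‖c‖ + ‖a‖ ^ 2))) * (1 + ‖c‖ + ‖a‖ ^ 2) =
        Real.exp z.re := by
      have := (hpos c).ne'
      field_simp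
    rw [this]
    exact Real.exp_zero ▸ Real.exp_lt_exp.2 hz

/-- These are the denominators of `sliceSnd`. After clearing `leadSnd`, the second becomes the first
with `c` replaced by `c + a²`, so one estimate handles both. -/
theorem lineNhd_ne_zero {a : ℂ} {x : ℂ × ℂ} (hx : x ∈ lineNhd a) :
    1 + x.1 - x.1 ^ 2 * x.2 ≠ 0 ∧ 1 - x.1 ^ 2 * leadSnd a x ≠ 0 := by
  obtain ⟨σ, c⟩ := x
  have hx' : 4 * ‖σ‖ * (1 + ‖c‖ + ‖a‖ ^ 2) < 1 := hx
  have hσ := norm_nonneg σ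
  have hσc : 0 ≤ ‖σ‖ * ‖c‖ := by positivity
  have hσa : 0 ≤ ‖σ‖ * ‖a‖ ^ 2 := by positivity
  have h1 : ‖σ‖ < 1 / 4 := by linarith
  have key : ∀ w : ℂ, ‖σ‖ * ‖w‖ < 1 / 4 → 1 + σ - σ ^ 2 * w ≠ 0 := fun w hw h0 => by
    have h2 : (1 : ℂ) = σ * (σ * w) - σ := by linear_combination h0
    have h3 : ‖(1 : ℂ)‖ ≤ ‖σ‖ * (‖σ‖ * ‖w‖) + ‖σ‖ := by
      calc ‖(1 : ℂ)‖ = ‖σ * (σ * w) - σ‖ := by rw [← h2]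
        _ ≤ ‖σ * (σ * w)‖ + ‖σ‖ := norm_sub_le _ _
        _ = _ := by rw [norm_mul, norm_mul]
    rw [norm_one] at h3
    have h4 : ‖σ‖ * (‖σ‖ * ‖w‖) ≤ 1 / 4 * (1 / 4) := by gcongr
    linarith
  have hK := key c (by linarith)
  refine ⟨hK, fun h0 => key (c + a ^ 2) ?_ ?_⟩
  · calc ‖σ‖ * ‖c + a ^ 2‖ ≤ ‖σ‖ * (‖c‖ + ‖a‖ ^ 2) := by
          gcongr
          exact (norm_add_le _ _).trans_eq (by rw [norm_pow])
      _ < 1 / 4 := by linarith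
  · simp only [leadSnd] at h0
    field_simp at h0
    linear_combination h0

/-- The connections whose coordinates near the locus `b₁ = 0` are defined. -/
def sndDomain : Set ConnCoeffs := {p | p.b 0 ≠ 0 ∧ p.normalizeSnd.c 3 ≠ 0}

theorem isOpen_sndDomain : IsOpen sndDomain := by
  have h : Continuous fun r : ConnCoeffs => r.c 3 := by fun_prop
  have h' := h.comp_continuousOn continuousOn_normalizeSnd
  exact h'.isOpen_inter_preimage (isOpen_b_ne_zero 0) isOpen_ne

theorem continuousOn_coordsSnd : ContinuousOn coordsSnd sndDomain := by
  have h : ContinuousOn (fun r : ConnCoeffs => (r.a 2 / r.c 3, r.c 2)) {r | r.c 3 ≠ 0} :=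
    ContinuousOn.prodMk (ContinuousOn.div (by fun_prop) (by fun_prop) fun r hr => hr) (by fun_prop)
  exact h.comp (continuousOn_normalizeSnd.mono fun p hp => hp.1) fun p hp => hp.2

theorem coordsSnd_eq_of_gaugeEquiv {p q : ConnCoeffs} (h : GaugeEquiv p q) (hp : p ∈ sndDomain) :
    q ∈ sndDomain ∧ coordsSnd p = coordsSnd q := by
  obtain ⟨h1, h2⟩ := normalizeSnd_eq_of_gaugeEquiv h hp.1
  exact ⟨⟨h1, h2 ▸ hp.2⟩, by rw [coordsSnd, h2, coordsSnd]⟩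

/-- With `e = c₃` and `a₂ = σ e`, the conditions at infinity read `b₁ = -σ² e` and `e (1 + σ - σ²
c₂) = a²`, the condition at `0` gives `c₀`, and the one at `1` gives `c₁` because `1 + b₁ ≠ 0`. A
general `Y` also covers the overlap `σ ≠ 0`. -/
theorem nonempty_homeomorph_chartSnd (θ₀ θ₁ a : ℂ) (ha : a ≠ 0) {Y : Set (ℂ × ℂ)}
    (hY : Y ⊆ lineNhd a) :
    Nonempty (Y ≃ₜ chartDomain θ₀ θ₁ a sndDomain coordsSnd Y) := by
  refine nonempty_homeomorph_chartDomain (sl := sliceSnd θ₀ θ₁ a) isOpen_sndDomain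
    continuousOn_coordsSnd (fun p q => coordsSnd_eq_of_gaugeEquiv) ?_ ?_ ?_
  · have h1 : ∀ x ∈ Y, 1 + x.1 - x.1 ^ 2 * x.2 ≠ 0 := fun x hx => (lineNhd_ne_zero (hY hx)).1
    have h2 : ∀ x ∈ Y, 1 - x.1 ^ 2 * leadSnd a x ≠ 0 := fun x hx => (lineNhd_ne_zero (hY hx)).2
    have h3 : ContinuousOn (leadSnd a) Y := by
      unfold leadSnd
      fun_prop (disch := assumption)
    refine continuousOn_of_coeffs ?_ ?_ ?_ ?_ continuousOn_const <;> intro i <;>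
      fin_cases i <;> simp [sliceSnd] <;> fun_prop (disch := assumption)
  · intro x hx
    obtain ⟨hK, hr⟩ := lineNhd_ne_zero (hY hx)
    have he : leadSnd a x * (1 + x.1 - x.1 ^ 2 * x.2) = a ^ 2 := div_mul_cancel₀ _ hK
    have he0 : leadSnd a x ≠ 0 := div_ne_zero (pow_ne_zero 2 ha) hK
    have hs : (sliceSnd θ₀ θ₁ a x).normalizeSnd = sliceSnd θ₀ θ₁ a x :=
      normalizeSnd_of_spec (by simp [sliceSnd])
    refine ⟨isAdmissible_iff.2 ⟨ha, Or.inl ?_, ?_, ?_, ?_, ?_, ?_⟩, rfl, ⟨?_, ?_⟩, ?_⟩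
    · simp [sliceSnd]
    · intro i
      fin_cases i <;> simp [sliceSnd]
    · simp [sliceSnd]
    · simp only [sliceSnd, Matrix.cons_val_zero, Matrix.cons_val_one, Matrix.cons_val]
      have := div_mul_cancel₀ (θ₁ ^ 2 / 4 - (x.1 * leadSnd a x) ^ 2) hr
      linear_combination this
    · simp [sliceSnd]
      ring
    · simp [sliceSnd]
      linear_combination he
    · simp [sliceSnd]
    · rw [hs]
      exact he0
    · rw [coordsSnd, hs]
      exact Prod.ext (mul_div_cancel_right₀ _ he0) rfl
  · intro p hp ht ⟨hb, hc⟩ hy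
    have hg := gaugeEquiv_normalizeSnd hb
    obtain ⟨hb0, ha0, ha1⟩ := normalizeSnd_spec hb
    obtain ⟨-, -, hd, h0, h1, h2, h3⟩ := isAdmissible_iff.1 (hp.of_gaugeEquiv hg)
    have ht' : p.normalizeSnd.t = a := hg.1.trans ht
    obtain ⟨hK, hr⟩ := lineNhd_ne_zero (hY hy)
    have hσ : (coordsSnd p).1 * p.normalizeSnd.c 3 = p.normalizeSnd.a 2 := div_mul_cancel₀ _ hc
    have hb1 : p.normalizeSnd.b 1 = -(coordsSnd p).1 ^ 2 * p.normalizeSnd.c 3 := by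
      refine mul_right_cancel₀ hc ?_
      rw [← hσ] at h2
      linear_combination h2
    rw [hb0, ha0, ha1, ← hσ, hb1] at h1
    rw [hb0, ha1, ← hσ, hb1, ht'] at h3
    rw [hb0, ha0] at h0
    have hlead : leadSnd a (coordsSnd p) = p.normalizeSnd.c 3 := by
      rw [leadSnd, div_eq_iff hK]
      have hc2 : (coordsSnd p).2 = p.normalizeSnd.c 2 := rfl
      rw [hc2]
      linear_combination -h3
    rw [hlead] at hr
    have hc0 : p.normalizeSnd.c 0 = θ₀ ^ 2 / 4 := by linear_combination h0
    have hc2 : (coordsSnd p).2 = p.normalizeSnd.c 2 := rfl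
    convert hg using 1
    refine ext_coeffs ?_ ?_ ?_ ?_ ht'.symm <;> intro i <;> fin_cases i
    · exact ha0.symm
    · exact ha1.symm
    · simp [sliceSnd, hlead, hσ]
    · exact hb0.symm
    · simp [sliceSnd, hlead, hb1]
    · exact hc0.symm
    · simp only [sliceSnd, hlead, hc2]
      change (_ / _ - _ - _ - _ : ℂ) = p.normalizeSnd.c 1
      rw [← h1, ← hc0]
      refine (sub_eq_zero.1 ?_)
      field_simp
      ring
    · rfl
    · exact hlead
    · simp [sliceSnd, hd, ha0]
    · simp [sliceSnd, hd, ha1]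
    · simp [sliceSnd, hd, hlead, hσ]

/-! ### Gluing the charts -/

theorem isSimplyConnected_firstAffinePart_inter (θ₀ θ₁ a : ℂ) (ha : a ≠ 0) :
    IsSimplyConnected ({m : ModuliSpace θ₀ θ₁ | m.t = a} ∩ firstAffinePart θ₀ θ₁) := by
  obtain ⟨e⟩ := nonempty_homeomorph_chartFst θ₀ θ₁ a ha
  have h := e.toHomotopyEquiv.simplyConnectedSpace_iff.1
    (isSimplyConnected_biconicSurface _ _).simplyConnectedSpace
  suffices hs : {m : ModuliSpace θ₀ θ₁ | m.t = a} ∩ firstAffinePart θ₀ θ₁ = chartDomain θ₀ θ₁ a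
      {p | p.b 1 ≠ 0} coordsFst (biconicSurface (θ₀ ^ 2 / 4) (θ₁ ^ 2 / 4)) from hs ▸ h
  ext m
  refine and_congr_right fun ht => ?_
  rw [mem_firstAffinePart_iff]
  -- The surface equations hold automatically for admissible connections, so the chart is the whole
  -- fibre.
  refine (and_iff_left_of_imp fun hb => ?_).symm
  have hg := gaugeEquiv_normalizeFst hb
  obtain ⟨hb1, ha1, ha2⟩ := normalizeFst_spec hb
  obtain ⟨-, -, hd, h0, h1, -, -⟩ := isAdmissible_iff.1 (m.rep.2.of_gaugeEquiv hg)
  rw [hb1, ha1, ha2] at h1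
  constructor
  · simp only [coordsFst]
    linear_combination -h0
  · simp only [coordsFst]
    linear_combination -h1

theorem isSimplyConnected_t_eq (θ₀ θ₁ a : ℂ) (ha : a ≠ 0) :
    IsSimplyConnected {m : ModuliSpace θ₀ θ₁ | m.t = a} := by
  let V : Set (ModuliSpace θ₀ θ₁) := {m | m.rep.1 ∈ sndDomain ∩ coordsSnd ⁻¹' lineNhd a}
  have hV : IsOpen V := isOpen_rep_mem
    (continuousOn_coordsSnd.isOpen_inter_preimage isOpen_sndDomain (isOpen_lineNhd a))
    fun p q h hp => by
      obtain ⟨h1, h2⟩ := coordsSnd_eq_of_gaugeEquiv h hp.1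
      exact ⟨h1, show coordsSnd q ∈ lineNhd a from h2 ▸ hp.2⟩
  refine isSimplyConnected_of_union (isOpen_firstAffinePart θ₀ θ₁) hV ?_
    (isSimplyConnected_firstAffinePart_inter θ₀ θ₁ a ha) ?_ ?_
  · intro m (hm : m.t = a)
    refine or_iff_not_imp_left.2 fun hb => ?_
    have hb1 : m.rep.1.b 1 = 0 := not_not.1 fun h => hb (mem_firstAffinePart_iff.2 h)
    obtain ⟨ht, hb', -⟩ := isAdmissible_iff.1 m.rep.2
    have hb0 : m.rep.1.b 0 ≠ 0 := hb'.resolve_right (not_not.2 hb1)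
    have hg := gaugeEquiv_normalizeSnd hb0
    obtain ⟨hb0', -, -⟩ := normalizeSnd_spec hb0
    have hb1' : m.rep.1.normalizeSnd.b 1 = 0 := by simp [normalizeSnd, transform, hb1]
    obtain ⟨ht', -, -, -, -, h2, h3⟩ := isAdmissible_iff.1 (m.rep.2.of_gaugeEquiv hg)
    have ha2 : m.rep.1.normalizeSnd.a 2 = 0 := by simpa [hb1'] using h2
    -- With `b₁ = a₂ = 0` the condition at infinity reads `c₃ = t² ≠ 0`, and `σ = 0` lies in the
    -- neighbourhood.
    refine ⟨⟨hb0, fun hc => ?_⟩, ?_⟩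
    · rw [hc, hb1', ha2] at h3
      exact pow_ne_zero 2 ht' (by simpa using h3.symm)
    · simp [lineNhd, coordsSnd, ha2]
  · obtain ⟨e⟩ := nonempty_homeomorph_chartSnd θ₀ θ₁ a ha (Y := lineNhd a) subset_rfl
    exact e.toHomotopyEquiv.simplyConnectedSpace_iff.1
      (isSimplyConnected_lineNhd a).simplyConnectedSpace
  · obtain ⟨e⟩ := nonempty_homeomorph_chartSnd θ₀ θ₁ a ha
      (Y := lineNhd a ∩ {x | x.1 ≠ 0}) inter_subset_left
    have := isPathConnected_iff_pathConnectedSpace.1 (isPathConnected_lineNhd_diff a)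
    have h := isPathConnected_iff_pathConnectedSpace.2
      (e.surjective.pathConnectedSpace e.continuous)
    convert h using 1
    ext m
    -- Since `a₂² = -b₁ c₃` with `c₃ ≠ 0`, the overlap with the first affine part is `σ ≠ 0`.
    have key : m.rep.1 ∈ sndDomain → (m.rep.1.b 1 ≠ 0 ↔ (coordsSnd m.rep.1).1 ≠ 0) := by
      rintro ⟨hb0, hc⟩
      have hg := gaugeEquiv_normalizeSnd hb0
      obtain ⟨-, -, -, -, -, h2, -⟩ := isAdmissible_iff.1 (m.rep.2.of_gaugeEquiv hg)
      have hb : m.rep.1.normalizeSnd.b 1 = 0 ↔ m.rep.1.b 1 = 0 := by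
        simp [normalizeSnd, transform, hb0]
      rw [not_iff_not, ← hb]
      simp only [coordsSnd, div_eq_zero_iff, hc, or_false]
      constructor
      · intro h
        simpa [h] using h2
      · intro h
        simpa [h, hc] using h2
    change (m.t = a ∧ m ∈ firstAffinePart θ₀ θ₁ ∧ m.rep.1 ∈ sndDomain ∧ _ ∈ lineNhd a) ↔
      (m.t = a ∧ m.rep.1 ∈ sndDomain ∧ _ ∈ lineNhd a ∧ (coordsSnd m.rep.1).1 ≠ 0)
    rw [mem_firstAffinePart_iff]
    tauto

end

theorem mainTheorem6 (θ₀ θ₁ a : ℂ) (ha : a ≠ 0) :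
    SimplyConnectedSpace {m : firstAffinePart θ₀ θ₁ // m.1.t = a} ∧
      SimplyConnectedSpace {m : ModuliSpace θ₀ θ₁ // m.t = a} := by
  refine ⟨?_, isSimplyConnected_t_eq θ₀ θ₁ a ha⟩
  have e : Topology.IsEmbedding (Subtype.val : firstAffinePart θ₀ θ₁ → ModuliSpace θ₀ θ₁) :=
    .subtypeVal
  have h := isSimplyConnected_firstAffinePart_inter θ₀ θ₁ a ha
  rw [inter_comm, ← Subtype.image_preimage_coe, e.isSimplyConnected_image] at h
  exact h
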